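/- Let $\Omega\subset\mathbb{R}^2$ be a domain (a nonempty connected open set) and let $u:\Omega\to\mathbb{R}$ be a nonconstant continuous function with the local median value property: there is a continuous function $R:\Omega\to\mathbb{R}$ with $0<R(x)\le \operatorname{dist}(x,\partial\Omega)$ such that, for all $x\in\Omega$ and all $0<r\le R(x)$ for which the circle $\partial B(x,r)$ lies in $\Omega$, $u(x)$ is the median of $u$ over $\partial B(x,r)$ with respect to arc length, that is, each of the sets $\{s\in\partial B(x,r): u(s)\ge u(x)\}$ and $\{s\in\partial B(x,r): u(s)\le u(x)\}$ has length at least $\pi r$. (If $\Omega=\mathbb{R}^2$, then $\operatorname{dist}(x,\partial\Omega)=\infty$.) Let $K$ be a path-connected component of a level set $u^{-1}(a)\subset\Omega$. Then $\overline{\partial K\cap\Omega}$ consists of straight line segments with endpoints on $\partial\Omega$, in the following sense. There is a nonempty family $\mathcal{S}$ of nondegenerate closed line segments, each having both endpoints on $\partial\Omega$ and all its other points in $\Omega$, where, if $\Omega$ is unbounded, closed half-lines with endpoint on $\partial\Omega$ and all other points in $\Omega$, and whole lines contained in $\Omega$, are also admitted, such that $$\partial K\cap\Omega=\Omega\cap\bigcup_{C\in\mathcal{S}}C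 \qquad\text{and}\qquad \overline{\partial K\cap\Omega}=\bigcup_{C\in\mathcal{S}}C\ \cup\ \Bigl(\overline{\textstyle\bigcup_{C\in\mathcal{S}}C}\cap\partial\Omega\Bigr).$$ -/

import Mathlib

open MeasureTheory Set

/-- `m` is a median of `f` over the set `E` with respect to the measure `μ`. -/
def IsMedian {α : Type*} [MeasurableSpace α] (μ : Measure α) (f : α → ℝ) (E : Set α) (m : ℝ) :
    Prop :=
  μ E / 2 ≤ μ {s ∈ E | m ≤ f s} ∧ μ E / 2 ≤ μ {s ∈ E | f s ≤ m}

/-- Arc length measure on the circle with center `x` and radius `r > 0` in the Euclidean plane `ℂ`: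
the image of `r dθ` on `(0, 2π]` under `θ ↦ x + r exp (i θ)`. -/
noncomputable def arcLength (x : ℂ) (r : ℝ) : Measure ℂ :=
  ENNReal.ofReal r •
    Measure.map (circleMap x r) ((volume : Measure ℝ).restrict (Ioc 0 (2 * Real.pi)))

/-- The local median value property of `u : Ω → ℝ` (only the values of `u` on `Ω` matter).
If the radius `r = R x` equals the distance from `x` to the boundary, the circle meets `∂Ω`, where
`u` has no values; nothing is required of such a circle. The distance is taken in `[0, ∞]`, so that
it is infinite when `Ω` is the whole plane. -/
def LocalMedianValueProperty (Ω : Set ℂ) (u : ℂ → ℝ) : Prop :=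
  ∃ R : ℂ → ℝ, ContinuousOn R Ω ∧
    (∀ x ∈ Ω, 0 < R x ∧ ENNReal.ofReal (R x) ≤ Metric.infEDist x (frontier Ω)) ∧
    ∀ x ∈ Ω, ∀ r : ℝ, 0 < r → r ≤ R x → Metric.sphere x r ⊆ Ω →
      IsMedian (arcLength x r) u (Metric.sphere x r) (u x)

/-- `C` is a nondegenerate closed straight line segment with both endpoints on `∂Ω` and all other
points in `Ω`; if `Ω` is unbounded, the segment may also extend to infinity in one direction (a
closed half-line whose endpoint is on `∂Ω`) or in both (a line contained in `Ω`). -/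
def IsSegmentAcross (Ω C : Set ℂ) : Prop :=
  (∃ p q : ℂ, p ≠ q ∧ p ∈ frontier Ω ∧ q ∈ frontier Ω ∧ openSegment ℝ p q ⊆ Ω ∧
    C = segment ℝ p q) ∨
  (∃ p v : ℂ, v ≠ 0 ∧ p ∈ frontier Ω ∧ (∀ t : ℝ, 0 < t → p + t • v ∈ Ω) ∧
    C = {z | ∃ t : ℝ, 0 ≤ t ∧ z = p + t • v}) ∨
  (∃ p v : ℂ, v ≠ 0 ∧ (∀ t : ℝ, p + t • v ∈ Ω) ∧ C = {z | ∃ t : ℝ, z = p + t • v})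

/-! The median property puts points of {u ≥ u z} and of {u ≤ u z} on every closed arc longer than
half of a small circle around z. The part of such a circle outside a disc with z on its boundary
contains an arc of this kind, so near none of its points z can {u ≥ a}, {u ≤ a} or {u = a} be
confined to a disc with z on its boundary (`Untouchable`). By a maximum argument, a component of
such a set in a closed disc D ⊆ Ω lies in the convex hull of its trace on ∂D
(`Untouchable.mem_convexHull`).

Conversely, let M be a component of {u = a} ∩ D, and suppose that w in the hull of M ∩ ∂D had, say,
u w < a. The component N of {u ≤ u w} ∩ D through w is disjoint from M, yet w lies in the boundary
hulls of both, which planar topology forbids (`disjoint_convexHull_of_disjoint`). So M is the hull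
of its trace on ∂D, hence convex.

The supporting line of M at its nearest point to a point outside K then cuts D in a chord contained
in ∂K. Limits give a chord through each point of ∂K in D (`LocalMedianValueProperty.exists_chord`).
Two nonparallel ones would, by convexity, make the point interior to K
(`LocalMedianValueProperty.orient_eq_zero`), so chords of overlapping discs continue each other
until ∂Ω is reached (`LocalMedianValueProperty.exists_line`). -/

/-! ### Arc length, and arcs longer than half a circle -/

/-- By periodicity of `circleMap`, any half-open interval of length 2π is a fundamental domain. The
free `t` allows the parameter window to be centred on a given arc. -/
theorem arcLength_apply (x : ℂ) (r t : ℝ) {T : Set ℂ} (hT : MeasurableSet T) :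
    arcLength x r T =
      ENNReal.ofReal r * volume (circleMap x r ⁻¹' T ∩ Ioc t (t + 2 * Real.pi)) := by
  have hm : Measurable (circleMap x r) := (continuous_circleMap x r).measurable
  have h2 : (0 : ℝ) < 2 * Real.pi := Real.two_pi_pos
  have key : volume (circleMap x r ⁻¹' T ∩ Ioc 0 (0 + 2 * Real.pi)) =
      volume (circleMap x r ⁻¹' T ∩ Ioc t (t + 2 * Real.pi)) := by
    refine (isAddFundamentalDomain_Ioc h2 0).measure_set_eq (isAddFundamentalDomain_Ioc h2 t)
      (hm hT) ?_
    rintro ⟨g, hg⟩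
    obtain ⟨n, rfl⟩ := AddSubgroup.mem_zmultiples_iff.1 hg
    ext θ
    have := (periodic_circleMap x r).zsmul n θ
    simp only [mem_preimage]
    change circleMap x r (n • (2 * Real.pi) + θ) ∈ T ↔ _
    rw [add_comm, this]
  rw [arcLength, Measure.smul_apply, Measure.map_apply hm hT,
    Measure.restrict_apply (hm hT), smul_eq_mul, ← key, zero_add]

theorem arcLength_sphere (x : ℂ) {r : ℝ} (hr : 0 < r) :
    arcLength x r (Metric.sphere x r) = ENNReal.ofReal r * ENNReal.ofReal (2 * Real.pi) := by
  rw [arcLength_apply x r 0 Metric.isClosed_sphere.measurableSet]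
  have : circleMap x r ⁻¹' Metric.sphere x r = univ := by
    ext θ; simp [circleMap, abs_of_pos hr]
  simp [this]

/-- A subset of a circle of at least half its length meets every closed arc of length more than
half of it. -/
theorem exists_mem_arc_of_half_le_arcLength {x : ℂ} {r : ℝ} (hr : 0 < r) {T : Set ℂ}
    (hT : MeasurableSet T) (h : arcLength x r (Metric.sphere x r) / 2 ≤ arcLength x r T)
    (θ₀ : ℝ) {η : ℝ} (hη : 0 < η) :
    ∃ θ ∈ Icc (θ₀ - (Real.pi / 2 + η)) (θ₀ + (Real.pi / 2 + η)), circleMap x r θ ∈ T := by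
  by_contra! hcon
  -- In the window of length 2π centred at `θ₀`, a set missing the arc has only two intervals of
  -- length π/2 - η left, less than half in total.
  rw [arcLength_sphere x hr, arcLength_apply x r (θ₀ - Real.pi) hT] at h
  have hr' : ENNReal.ofReal r ≠ 0 := by simpa using hr
  have hsub : circleMap x r ⁻¹' T ∩ Ioc (θ₀ - Real.pi) (θ₀ - Real.pi + 2 * Real.pi) ⊆
      Ioc (θ₀ - Real.pi) (θ₀ - (Real.pi / 2 + η)) ∪
        Ioc (θ₀ + (Real.pi / 2 + η)) (θ₀ + Real.pi) := by
    rintro θ ⟨hθ, h1, h2⟩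
    by_cases h3 : θ ≤ θ₀ - (Real.pi / 2 + η)
    · exact Or.inl ⟨h1, h3⟩
    · refine Or.inr ⟨?_, by linarith⟩
      by_contra! h4
      exact hcon θ ⟨(not_le.1 h3).le, h4⟩ hθ
  have h5 := (measure_mono (μ := volume) hsub).trans (measure_union_le _ _)
  rw [Real.volume_Ioc, Real.volume_Ioc] at h5
  have h6 : ENNReal.ofReal (θ₀ - (Real.pi / 2 + η) - (θ₀ - Real.pi)) +
      ENNReal.ofReal (θ₀ + Real.pi - (θ₀ + (Real.pi / 2 + η))) < ENNReal.ofReal Real.pi := by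
    have e1 : θ₀ - (Real.pi / 2 + η) - (θ₀ - Real.pi) = Real.pi / 2 - η := by ring
    have e2 : θ₀ + Real.pi - (θ₀ + (Real.pi / 2 + η)) = Real.pi / 2 - η := by ring
    have hlt : ENNReal.ofReal (Real.pi / 2 - η) < ENNReal.ofReal (Real.pi / 2) :=
      (ENNReal.ofReal_lt_ofReal_iff (by positivity)).2 (by linarith)
    rw [e1, e2]
    calc _ < ENNReal.ofReal (Real.pi / 2) + ENNReal.ofReal (Real.pi / 2) :=
          ENNReal.add_lt_add hlt hlt
      _ = _ := by rw [← ENNReal.ofReal_add (by positivity) (by positivity), add_halves]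
  have h7 : ENNReal.ofReal r * ENNReal.ofReal (2 * Real.pi) / 2 =
      ENNReal.ofReal r * ENNReal.ofReal Real.pi := by
    rw [ENNReal.ofReal_mul (by norm_num : (0 : ℝ) ≤ 2), ENNReal.ofReal_ofNat, mul_left_comm,
      mul_comm (2 : ENNReal), ENNReal.mul_div_cancel_right (by norm_num) (by norm_num)]
  rw [h7, ENNReal.mul_le_mul_iff_right hr' ENNReal.ofReal_ne_top] at h
  exact absurd (h.trans h5) (not_le.2 h6)

/-- Every circle around `z ≠ c` has a closed arc of length more than half of the circle outside
the disc around `c` through `z`. -/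
theorem exists_arc_outside_disc {z c : ℂ} (hzc : z ≠ c) {r : ℝ} (hr : 0 < r) :
    ∃ θ₀ η : ℝ, 0 < η ∧ ∀ θ ∈ Icc (θ₀ - (Real.pi / 2 + η)) (θ₀ + (Real.pi / 2 + η)),
      dist z c < dist (circleMap z r θ) c := by
  have hρ : 0 < ‖z - c‖ := norm_pos_iff.2 (sub_ne_zero.2 hzc)
  -- By the law of cosines the squared distance to `c` changes by r² + 2r‖z - c‖ cos. The second
  -- bound keeps this at least r²/2; the first keeps the angle within [-π, π], where the cosine
  -- decreases in the absolute value.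
  set η : ℝ := min (Real.pi / 2) (r / (4 * ‖z - c‖)) with hη
  have hη0 : 0 < η := by have := Real.pi_pos; positivity
  refine ⟨(z - c).arg, η, hη0, fun θ hθ => ?_⟩
  have hcos : -(r / (4 * ‖z - c‖)) ≤ Real.cos (θ - (z - c).arg) := by
    have hab : |θ - (z - c).arg| ≤ Real.pi / 2 + η := by
      rw [abs_le]; constructor <;> linarith [hθ.1, hθ.2]
    have h1 : Real.cos (Real.pi / 2 + η) ≤ Real.cos (θ - (z - c).arg) := by
      rw [← Real.cos_abs (θ - (z - c).arg)]
      refine Real.cos_le_cos_of_nonneg_of_le_pi (abs_nonneg _) ?_ hab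
      linarith [min_le_left (Real.pi / 2) (r / (4 * ‖z - c‖))]
    have h2 : Real.cos (Real.pi / 2 + η) = - Real.sin η := by
      rw [add_comm, Real.cos_add_pi_div_two]
    have h3 : Real.sin η ≤ r / (4 * ‖z - c‖) :=
      (Real.sin_le hη0.le).trans (min_le_right _ _)
    linarith
  have hsq : ‖circleMap z r θ - c‖ ^ 2 =
      ‖z - c‖ ^ 2 + 2 * r * ‖z - c‖ * Real.cos (θ - (z - c).arg) + r ^ 2 := by
    have e1 : (z - c).re = ‖z - c‖ * Real.cos (z - c).arg := (Complex.norm_mul_cos_arg _).symm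
    have e2 : (z - c).im = ‖z - c‖ * Real.sin (z - c).arg := (Complex.norm_mul_sin_arg _).symm
    have e3 : (circleMap z r θ - c).re = (z - c).re + r * Real.cos θ := by
      simp [circleMap, Complex.exp_ofReal_mul_I_re]; ring
    have e4 : (circleMap z r θ - c).im = (z - c).im + r * Real.sin θ := by
      simp [circleMap, Complex.exp_ofReal_mul_I_im]; ring
    rw [Complex.sq_norm, Complex.normSq_apply, e3, e4, e1, e2, Real.cos_sub]
    linear_combination ‖z - c‖ ^ 2 * (Real.sin_sq_add_cos_sq (z - c).arg) +
      r ^ 2 * Real.sin_sq_add_cos_sq θ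
  rw [dist_eq_norm, dist_eq_norm]
  refine lt_of_pow_lt_pow_left₀ 2 (norm_nonneg _) ?_
  rw [hsq]
  have h4 : 2 * r * ‖z - c‖ * -(r / (4 * ‖z - c‖)) = - (r ^ 2 / 2) := by
    field_simp; ring
  have h5 := mul_le_mul_of_nonneg_left hcos (by positivity : 0 ≤ 2 * r * ‖z - c‖)
  nlinarith [sq_pos_of_pos hr]

/-! ### Untouchable sets -/

/-- A set none of whose points `z` has a neighbourhood in which the set stays in a disc whose
boundary passes through `z`. -/
def Untouchable (X : Set ℂ) : Prop :=
  ∀ z ∈ X, ∀ c : ℂ, ∀ ε > 0, ∃ w ∈ X, dist w z < ε ∧ dist z c < dist w c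

/-- For c = z it is enough to find a nearby point other than z, and any other centre supplies one.
-/
theorem untouchable_of_ne {X : Set ℂ}
    (h : ∀ z ∈ X, ∀ c : ℂ, z ≠ c → ∀ ε > 0, ∃ w ∈ X, dist w z < ε ∧ dist z c < dist w c) :
    Untouchable X := by
  intro z hz c ε hε
  by_cases hc : z = c
  · obtain ⟨w, hw, h1, h2⟩ := h z hz (z + 1) (by simp) ε hε
    refine ⟨w, hw, h1, ?_⟩
    rw [← hc, dist_self, dist_pos]
    rintro rfl
    exact lt_irrefl _ h2
  · exact h z hz c hc ε hε

section
variable {Ω : Set ℂ} {u : ℂ → ℝ}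

/-- The local median value property yields, close to any point `z`, arcs outside any disc through
`z` on which `u` takes values on both sides of `u z`. -/
theorem LocalMedianValueProperty.exists_arc (hmed : LocalMedianValueProperty Ω u)
    (hΩ : IsOpen Ω) (hu : ContinuousOn u Ω) {z : ℂ} (hz : z ∈ Ω) {c : ℂ} (hzc : z ≠ c)
    {ε : ℝ} (hε : 0 < ε) :
    ∃ I : Set ℂ, IsPreconnected I ∧ I ⊆ Ω ∧ (∀ w ∈ I, dist w z < ε ∧ dist z c < dist w c) ∧
      (∃ w ∈ I, u z ≤ u w) ∧ ∃ w ∈ I, u w ≤ u z := by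
  obtain ⟨R, -, hR, hmed⟩ := hmed
  obtain ⟨δ, hδ, hball⟩ := Metric.isOpen_iff.1 hΩ z hz
  set r : ℝ := min (R z) (min (δ / 2) (ε / 2)) with hr
  have hr0 : 0 < r := by have := (hR z hz).1; positivity
  have hrδ : r < δ := by
    have : r ≤ δ / 2 := (min_le_right _ _).trans (min_le_left _ _)
    linarith
  have hrε : r < ε := by
    have : r ≤ ε / 2 := (min_le_right _ _).trans (min_le_right _ _)
    linarith
  have hsph : Metric.sphere z r ⊆ Ω := fun w hw => hball (by
    rw [Metric.mem_ball, Metric.mem_sphere.1 hw]; exact hrδ)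
  obtain ⟨h1, h2⟩ := hmed z hz r hr0 (min_le_left _ _) hsph
  have hus := hu.mono hsph
  have m1 : MeasurableSet {s ∈ Metric.sphere z r | u z ≤ u s} :=
    (hus.preimage_isClosed_of_isClosed Metric.isClosed_sphere isClosed_Ici).measurableSet
  have m2 : MeasurableSet {s ∈ Metric.sphere z r | u s ≤ u z} :=
    (hus.preimage_isClosed_of_isClosed Metric.isClosed_sphere isClosed_Iic).measurableSet
  obtain ⟨θ₀, η, hη, hout⟩ := exists_arc_outside_disc hzc hr0
  obtain ⟨θ₁, hθ₁, hm₁⟩ := exists_mem_arc_of_half_le_arcLength hr0 m1 h1 θ₀ hη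
  obtain ⟨θ₂, hθ₂, hm₂⟩ := exists_mem_arc_of_half_le_arcLength hr0 m2 h2 θ₀ hη
  refine ⟨circleMap z r '' Icc (θ₀ - (Real.pi / 2 + η)) (θ₀ + (Real.pi / 2 + η)),
    isPreconnected_Icc.image _ (continuous_circleMap z r).continuousOn, ?_, ?_,
    ⟨_, mem_image_of_mem _ hθ₁, hm₁.2⟩, ⟨_, mem_image_of_mem _ hθ₂, hm₂.2⟩⟩
  · rintro _ ⟨θ, -, rfl⟩
    exact hsph (circleMap_mem_sphere z hr0.le θ)
  · rintro _ ⟨θ, hθ, rfl⟩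
    refine ⟨?_, hout θ hθ⟩
    rw [Metric.mem_sphere.1 (circleMap_mem_sphere z hr0.le θ)]
    exact hrε

theorem LocalMedianValueProperty.untouchable_ge (hmed : LocalMedianValueProperty Ω u)
    (hΩ : IsOpen Ω) (hu : ContinuousOn u Ω) (a : ℝ) : Untouchable {z ∈ Ω | a ≤ u z} := by
  refine untouchable_of_ne fun z hz c hzc ε hε => ?_
  obtain ⟨I, -, hI, h, ⟨w, hw, hle⟩, -⟩ := hmed.exists_arc hΩ hu hz.1 hzc hε
  exact ⟨w, ⟨hI hw, hz.2.trans hle⟩, h w hw⟩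

theorem LocalMedianValueProperty.untouchable_le (hmed : LocalMedianValueProperty Ω u)
    (hΩ : IsOpen Ω) (hu : ContinuousOn u Ω) (a : ℝ) : Untouchable {z ∈ Ω | u z ≤ a} := by
  refine untouchable_of_ne fun z hz c hzc ε hε => ?_
  obtain ⟨I, -, hI, h, -, ⟨w, hw, hle⟩⟩ := hmed.exists_arc hΩ hu hz.1 hzc hε
  exact ⟨w, ⟨hI hw, hle.trans hz.2⟩, h w hw⟩

/-- The arc is connected and carries values of u on both sides of u z, so it also carries the value
u z itself. -/
theorem LocalMedianValueProperty.untouchable_eq (hmed : LocalMedianValueProperty Ω u)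
    (hΩ : IsOpen Ω) (hu : ContinuousOn u Ω) (a : ℝ) : Untouchable {z ∈ Ω | u z = a} := by
  refine untouchable_of_ne fun z hz c hzc ε hε => ?_
  obtain ⟨I, hI, hIΩ, h, ⟨w₁, hw₁, h₁⟩, ⟨w₂, hw₂, h₂⟩⟩ := hmed.exists_arc hΩ hu hz.1 hzc hε
  obtain ⟨w, hw, he⟩ := hI.intermediate_value hw₂ hw₁ (hu.mono hIΩ) ⟨h₂, h₁⟩
  exact ⟨w, ⟨hIΩ hw, he.trans hz.2⟩, h w hw⟩

end

/-! ### Compactness, convex hulls and separation by circles -/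

/-- Carathéodory's theorem in the plane. -/
theorem exists_triangle_of_mem_convexHull {Q : Set ℂ} {z : ℂ} (hz : z ∈ convexHull ℝ Q) :
    z ∈ Q ∨
    (∃ p ∈ Q, ∃ q ∈ Q, p ≠ q ∧ ∃ α β : ℝ, 0 < α ∧ 0 < β ∧ α + β = 1 ∧ z = α • p + β • q) ∨
    ∃ p ∈ Q, ∃ q ∈ Q, ∃ r ∈ Q, p ≠ q ∧ q ≠ r ∧ r ≠ p ∧ ∃ α β γ : ℝ, 0 < α ∧ 0 < β ∧ 0 < γ ∧
      α + β + γ = 1 ∧ z = α • p + β • q + γ • r := by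
  obtain ⟨ι, _, y, w, hy, hind, hw, hsum, rfl⟩ := eq_pos_convex_span_of_mem_convexHull hz
  have hcard : Fintype.card ι ≤ 3 := by
    have h := hind.card_le_finrank_succ
    have h2 : Module.finrank ℝ (vectorSpan ℝ (range y)) ≤ 2 := by
      simpa [Complex.finrank_real_complex] using
        Submodule.finrank_le (vectorSpan ℝ (range y))
    omega
  have hyQ : ∀ i, y i ∈ Q := fun i => hy (mem_range_self i)
  have hinj := hind.injective
  obtain ⟨n, hn⟩ : ∃ n, Fintype.card ι = n := ⟨_, rfl⟩
  let e : Fin n ≃ ι := (Fintype.equivFinOfCardEq hn).symm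
  have hs1 : ∑ i, w (e i) = 1 := by rw [e.sum_comp]; exact hsum
  have hs2 : ∑ i, w (e i) • y (e i) = ∑ i, w i • y i := e.sum_comp (fun i => w i • y i)
  have hne : ∀ {i j : Fin n}, i ≠ j → y (e i) ≠ y (e j) := fun h h' => h (e.injective (hinj h'))
  rw [← hs2]
  rw [hn] at hcard
  interval_cases n
  · simp at hs1
  · rw [Fin.sum_univ_one] at hs1 ⊢
    left
    rw [hs1, one_smul]
    exact hyQ _
  · rw [Fin.sum_univ_two] at hs1 ⊢
    exact Or.inr (Or.inl ⟨_, hyQ _, _, hyQ _, hne (by decide), _, _, hw _, hw _, hs1, rfl⟩)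
  · rw [Fin.sum_univ_three] at hs1 ⊢
    exact Or.inr (Or.inr ⟨_, hyQ _, _, hyQ _, _, hyQ _, hne (by decide), hne (by decide),
      hne (by decide), _, _, _, hw _, hw _, hw _, hs1, rfl⟩)

/-- By Carathéodory's theorem the hull is a continuous image of the product of a simplex and three
copies of Q. -/
theorem IsCompact.isCompact_convexHull_complex {Q : Set ℂ} (hQ : IsCompact Q) :
    IsCompact (convexHull ℝ Q) := by
  have h1 : IsCompact ((fun x : (Fin 3 → ℝ) × ℂ × ℂ × ℂ =>
      x.1 0 • x.2.1 + x.1 1 • x.2.2.1 + x.1 2 • x.2.2.2) ''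
      (stdSimplex ℝ (Fin 3) ×ˢ Q ×ˢ Q ×ˢ Q)) :=
    ((isCompact_stdSimplex ℝ (Fin 3)).prod (hQ.prod (hQ.prod hQ))).image (by fun_prop)
  convert h1 using 1
  ext z
  constructor
  · intro hz
    rcases exists_triangle_of_mem_convexHull hz with h | ⟨p, hp, q, hq, -, α, β, hα, hβ, h, rfl⟩ |
      ⟨p, hp, q, hq, r, hr, -, -, -, α, β, γ, hα, hβ, hγ, h, rfl⟩
    · exact ⟨(![1, 0, 0], z, z, z), ⟨⟨by intro i; fin_cases i <;> simp,
        by simp [Fin.sum_univ_three]⟩, h, h, h⟩, by simp⟩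
    · exact ⟨(![α, β, 0], p, q, q), ⟨⟨by intro i; fin_cases i <;> simp [hα.le, hβ.le],
        by simp [Fin.sum_univ_three, h]⟩, hp, hq, hq⟩, by simp⟩
    · exact ⟨(![α, β, γ], p, q, r), ⟨⟨by intro i; fin_cases i <;> simp [hα.le, hβ.le, hγ.le],
        by simp [Fin.sum_univ_three, h]⟩, hp, hq, hr⟩, by simp⟩
  · rintro ⟨⟨w, p, q, r⟩, ⟨⟨hw, hs⟩, hp, hq, hr⟩, rfl⟩
    rw [Fin.sum_univ_three] at hs
    simp only at hp hq hr hs ⊢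
    have hc := convex_convexHull ℝ Q
    have hmem := hc.sum_mem (t := Finset.univ) (w := w) (z := ![p, q, r]) (fun i _ => hw i)
      (by rw [Fin.sum_univ_three]; exact hs)
      (by intro i _; fin_cases i <;> simp [subset_convexHull ℝ Q hp, subset_convexHull ℝ Q hq,
            subset_convexHull ℝ Q hr])
    simpa [Fin.sum_univ_three] using hmem

/-- In a compact Hausdorff space, a neighbourhood of a connected component contains a clopen
neighbourhood of it. -/
theorem exists_isClopen_subset_of_connectedComponent_subset {Y : Type*} [TopologicalSpace Y]
    [T2Space Y] [CompactSpace Y] {x : Y} {U : Set Y} (hU : IsOpen U)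
    (h : connectedComponent x ⊆ U) : ∃ P : Set Y, IsClopen P ∧ x ∈ P ∧ P ⊆ U := by
  have h' : Uᶜ ∩ ⋂ s : { s : Set Y // IsClopen s ∧ x ∈ s }, (s : Set Y) = ∅ := by
    rw [← connectedComponent_eq_iInter_isClopen]
    rw [← disjoint_iff_inter_eq_empty]
    exact disjoint_left.2 fun y hy hy' => hy (h hy')
  obtain ⟨t, ht⟩ := hU.isClosed_compl.isCompact.elim_finite_subfamily_closed _
    (fun s : { s : Set Y // IsClopen s ∧ x ∈ s } => s.2.1.1) h'
  refine ⟨⋂ i ∈ t, (i : Set Y), isClopen_biInter_finset fun i _ => i.2.1,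
    mem_iInter₂.2 fun i _ => i.2.2, fun y hy => ?_⟩
  by_contra hyU
  exact (ht.subset ⟨hyU, hy⟩ : y ∈ (∅ : Set Y)).elim

/-- A compact convex set and a point outside of it are separated by a circle. -/
theorem exists_center_of_notMem {H : Set ℂ} (hH : IsCompact H) (hconv : Convex ℝ H) {z : ℂ}
    (hz : z ∉ H) : ∃ c : ℂ, ∀ w ∈ H, dist w c < dist z c := by
  obtain ⟨f, s, hf, hs⟩ := geometric_hahn_banach_closed_point hconv hH.isClosed hz
  obtain ⟨B, hB⟩ := hH.isBounded.exists_norm_le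
  obtain ⟨v, rfl⟩ := (InnerProductSpace.toDual ℝ ℂ).surjective f
  simp only [InnerProductSpace.toDual_apply_apply] at hf hs
  -- A huge disc approximates the separating half-plane. With centre -k v, this k makes the linear
  -- term outweigh the variation of ‖w‖², which is at most B² on `H`.
  set k : ℝ := (B ^ 2 + 1) / (inner ℝ v z - s) with hk
  have hpos : 0 < inner ℝ v z - s := sub_pos.2 hs
  have hk0 : 0 < k := by positivity
  have hexp : ∀ w : ℂ, ‖w - -(k • v)‖ ^ 2 = ‖w‖ ^ 2 + 2 * k * inner ℝ v w + ‖k • v‖ ^ 2 := by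
    intro w
    rw [sub_neg_eq_add, norm_add_sq_real, real_inner_smul_right, real_inner_comm]
    ring
  refine ⟨-(k • v), fun w hw => ?_⟩
  rw [dist_eq_norm, dist_eq_norm]
  refine lt_of_pow_lt_pow_left₀ 2 (norm_nonneg _) ?_
  rw [hexp, hexp]
  have h1 : ‖w‖ ^ 2 ≤ B ^ 2 := pow_le_pow_left₀ (norm_nonneg _) (hB w hw) 2
  have h2 : k * (inner ℝ v z - s) = B ^ 2 + 1 := div_mul_cancel₀ _ hpos.ne'
  have h3 := mul_lt_mul_of_pos_left (hf w hw) hk0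
  nlinarith [sq_nonneg ‖z‖]

/-! ### Maximum principle for untouchable sets -/

/-- The part of an untouchable set in a disc lies, component by component, in the convex hull of
its part on the boundary circle. -/
theorem Untouchable.mem_convexHull {X : Set ℂ} (hX : Untouchable X) {c : ℂ} {ρ : ℝ}
    (hc : IsCompact (X ∩ Metric.closedBall c ρ)) {z : ℂ} (hz : z ∈ X ∩ Metric.closedBall c ρ) :
    z ∈ convexHull ℝ (connectedComponentIn (X ∩ Metric.closedBall c ρ) z ∩
      Metric.sphere c ρ) := by
  set Y := X ∩ Metric.closedBall c ρ with hY
  set N := connectedComponentIn Y z with hN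
  by_contra hcon
  have : CompactSpace Y := isCompact_iff_compactSpace.1 hc
  have hNimg : N = (↑) '' connectedComponent (⟨z, hz⟩ : Y) := connectedComponentIn_eq_image hz
  have hNc : IsCompact N := by
    rw [hNimg]
    exact isClosed_connectedComponent.isCompact.image continuous_subtype_val
  obtain ⟨o, ho⟩ := exists_center_of_notMem
    (hNc.inter_right Metric.isClosed_sphere).isCompact_convexHull_complex (convex_convexHull ℝ _)
    hcon
  -- The component need not be open in `Y`, so it is enlarged to a clopen `P` inside `U`. A point of
  -- `P` farthest from `o` is at least as far as `z`, hence in the open disc. Nearby points of `X`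
  -- then belong to `P`, so the maximum contradicts untouchability.
  let U : Set Y := {y | dist (y : ℂ) o < dist z o} ∪ {y | (y : ℂ) ∈ Metric.ball c ρ}
  have hU : IsOpen U :=
    (isOpen_lt (by fun_prop) continuous_const).union
      (Metric.isOpen_ball.preimage continuous_subtype_val)
  have hsub : connectedComponent (⟨z, hz⟩ : Y) ⊆ U := by
    intro y hy
    by_cases hb : (y : ℂ) ∈ Metric.ball c ρ
    · exact Or.inr hb
    · refine Or.inl (ho _ (subset_convexHull ℝ _ ⟨hNimg ▸ mem_image_of_mem _ hy, ?_⟩))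
      exact le_antisymm y.2.2 (not_lt.1 hb)
  obtain ⟨P, hP, hzP, hPU⟩ := exists_isClopen_subset_of_connectedComponent_subset hU hsub
  obtain ⟨p, hpP, hmax⟩ := hP.1.isCompact.exists_isMaxOn ⟨_, hzP⟩
    (f := fun y : Y => dist (y : ℂ) o) (by fun_prop)
  have hpb : (p : ℂ) ∈ Metric.ball c ρ := by
    rcases hPU hpP with h | h
    · exact absurd h (not_lt.2 (isMaxOn_iff.1 hmax _ hzP))
    · exact h
  obtain ⟨V, hV, hVP⟩ := isOpen_induced_iff.1 hP.2
  have hpV : (p : ℂ) ∈ V := by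
    have : p ∈ Subtype.val ⁻¹' V := hVP ▸ hpP
    exact this
  obtain ⟨ε, hε, hball⟩ := Metric.isOpen_iff.1 (hV.inter Metric.isOpen_ball) p ⟨hpV, hpb⟩
  obtain ⟨w, hwX, hw1, hw2⟩ := hX p p.2.1 o ε hε
  have hw := hball hw1
  have hwY : w ∈ Y := ⟨hwX, Metric.ball_subset_closedBall hw.2⟩
  have hwP : (⟨w, hwY⟩ : Y) ∈ P := by rw [← hVP]; exact hw.1
  exact absurd hw2 (not_lt.2 (isMaxOn_iff.1 hmax _ hwP))

/-! ### Crossing of continua in a disc -/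

/-- The points of a connected set are joined by paths in any of its thickenings within a convex
set. -/
theorem IsPreconnected.joinedIn_thickening {N D : Set ℂ} (hN : IsPreconnected N)
    (hD : Convex ℝ D) (hND : N ⊆ D) {δ : ℝ} (hδ : 0 < δ) {x y : ℂ} (hx : x ∈ N) (hy : y ∈ N) :
    JoinedIn (D ∩ Metric.thickening δ N) x y := by
  have hstep : ∀ v ∈ N, ∀ w ∈ N, dist w v < δ → JoinedIn (D ∩ Metric.thickening δ N) v w := by
    intro v hv w hw hwv
    have hconv : Convex ℝ (D ∩ Metric.ball v δ) := hD.inter (convex_ball v δ)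
    refine JoinedIn.mono ?_ (inter_subset_inter_right D (Metric.ball_subset_thickening hv δ))
    exact (hconv.isPathConnected ⟨v, hND hv, Metric.mem_ball_self hδ⟩).joinedIn v
      ⟨hND hv, Metric.mem_ball_self hδ⟩ w ⟨hND hw, hwv⟩
  refine hN.induction₂ (fun v w => JoinedIn (D ∩ Metric.thickening δ N) v w) (fun v hv => ?_)
    (fun _ _ _ _ _ _ h1 h2 => h1.trans h2) (fun _ _ _ _ h => h.symm) hx hy
  filter_upwards [self_mem_nhdsWithin, mem_nhdsWithin_of_mem_nhds (Metric.ball_mem_nhds v hδ)]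
    with w hw hwv using hstep v hv w hw hwv

/-- The signed area of the parallelogram spanned by `b - a` and `c - a`. -/
def orient (a b c : ℂ) : ℝ := (b.re - a.re) * (c.im - a.im) - (b.im - a.im) * (c.re - a.re)

/-- Along a path in an open half-plane with the origin on its boundary, the argument of
the endpoints increases if they are positively oriented. -/
theorem im_lt_im_of_half_plane {k : ℝ → ℂ} (hk : Continuous k) {d : ℂ}
    (hd : ∀ t ∈ Icc (0 : ℝ) 1, 0 < inner ℝ d (Complex.exp (k t)))
    (ho : 0 < orient 0 (Complex.exp (k 0)) (Complex.exp (k 1))) : (k 0).im < (k 1).im := by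
  by_contra! hle
  have hsin : 0 < Real.sin ((k 1).im - (k 0).im) := by
    simp only [orient, Complex.exp_re, Complex.exp_im, Complex.zero_re, Complex.zero_im,
      sub_zero] at ho
    have : Real.exp (k 0).re * Real.exp (k 1).re * Real.sin ((k 1).im - (k 0).im) > 0 := by
      rw [Real.sin_sub]; linarith
    exact (pos_iff_pos_of_mul_pos this).1 (by positivity)
  -- If the argument does not increase, positive orientation forces it to drop by more than π. At an
  -- intermediate time the path then points opposite to its start, outside the half-plane.
  have hlt : (k 1).im < (k 0).im - Real.pi := by
    by_contra! h
    have := Real.sin_nonpos_of_nonpos_of_neg_pi_le (x := (k 1).im - (k 0).im) (by linarith)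
      (by linarith)
    linarith
  obtain ⟨t, ht, htk⟩ := intermediate_value_Icc' zero_le_one
    (f := fun t => (k t).im) (by fun_prop) ⟨hlt.le, by linarith [Real.pi_pos]⟩
  have h0 := hd 0 ⟨le_rfl, zero_le_one⟩
  have h1 := hd t ht
  have hexp : Complex.exp (k t) = -(Real.exp ((k t).re - (k 0).re)) • Complex.exp (k 0) := by
    simp only at htk
    apply Complex.ext
    · rw [Complex.exp_re, htk, Complex.smul_re, Complex.exp_re, Real.cos_sub_pi, smul_eq_mul,
        Real.exp_sub]
      field_simp
    · rw [Complex.exp_im, htk, Complex.smul_im, Complex.exp_im, Real.sin_sub_pi, smul_eq_mul,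
        Real.exp_sub]
      field_simp
  rw [hexp, real_inner_smul_right] at h1
  have := mul_pos (Real.exp_pos ((k t).re - (k 0).re)) h0
  linarith

/-- The disc touches its tangent line at `e` only in `e`. This supplies the half-planes needed for
`im_lt_im_of_half_plane`. -/
theorem inner_pos_of_mem_sphere {c e w : ℂ} {ρ : ℝ} (he : e ∈ Metric.sphere c ρ)
    (hw : w ∈ Metric.closedBall c ρ) (hne : w ≠ e) : 0 < inner ℝ (e - c) (e - w) := by
  have h1 : ‖e - c‖ = ρ := by rw [← dist_eq_norm]; exact he
  have h2 : ‖w - c‖ ≤ ρ := by rw [← dist_eq_norm]; exact hw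
  have h3 : ‖w - c‖ ^ 2 ≤ ‖e - c‖ ^ 2 := by
    rw [h1]; exact pow_le_pow_left₀ (norm_nonneg _) h2 2
  have h4 : 0 < ‖e - w‖ ^ 2 := by
    have := norm_pos_iff.2 (sub_ne_zero.2 hne.symm); positivity
  have h5 : w - c = (e - c) - (e - w) := by ring
  rw [h5, norm_sub_sq_real] at h3
  linarith

/-- Two chords of a circle, the endpoints of the second of which lie on different sides of
the first: the endpoints of the first lie on different sides of the second. -/
theorem orient_of_interlaced {c : ℂ} {ρ : ℝ} {e₁ e₂ f₁ f₂ : ℂ} (he₁ : e₁ ∈ Metric.sphere c ρ)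
    (he₂ : e₂ ∈ Metric.sphere c ρ) (hf₁ : f₁ ∈ Metric.sphere c ρ) (hf₂ : f₂ ∈ Metric.sphere c ρ)
    (h₁ : orient e₁ e₂ f₁ < 0) (h₂ : 0 < orient e₁ e₂ f₂) :
    0 < orient f₁ f₂ e₁ ∧ orient f₁ f₂ e₂ < 0 := by
  have hne : e₁ ≠ e₂ := by rintro rfl; simp [orient] at h₁
  -- Parameter at which the chord from `f₁` to `f₂` meets the line through `e₁` and `e₂`, namely in
  -- `x`. As an inner point of a chord, `x` lies in the open disc.
  set l : ℝ := -orient e₁ e₂ f₁ / (orient e₁ e₂ f₂ - orient e₁ e₂ f₁) with hl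
  have hden : 0 < orient e₁ e₂ f₂ - orient e₁ e₂ f₁ := by linarith
  have hl0 : 0 < l := div_pos (by linarith) hden
  have hl1 : l < 1 := (div_lt_one hden).2 (by linarith)
  have hlm : l * (orient e₁ e₂ f₂ - orient e₁ e₂ f₁) = -orient e₁ e₂ f₁ :=
    div_mul_cancel₀ _ hden.ne'
  set x : ℂ := f₁ + l • (f₂ - f₁) with hx
  have hxo : orient e₁ e₂ x = 0 := by
    simp only [orient, hx, Complex.add_re, Complex.add_im, Complex.smul_re, Complex.smul_im,
      Complex.sub_re, Complex.sub_im, smul_eq_mul] at hlm ⊢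
    linarith
  have hfne : f₁ ≠ f₂ := by rintro rfl; linarith
  have hxball : x ∈ Metric.ball c ρ := by
    rw [← interior_closedBall c (by
      rintro rfl
      simp only [Metric.sphere_zero, mem_singleton_iff] at hf₁ hf₂
      exact hfne (hf₁.trans hf₂.symm))]
    have := (strictConvex_closedBall ℝ c ρ) (Metric.sphere_subset_closedBall hf₁)
      (Metric.sphere_subset_closedBall hf₂) hfne (sub_pos.2 hl1) hl0 (by ring)
    convert this using 1
    rw [hx, sub_smul, smul_sub, one_smul]; ring
  have hd : 0 < (e₂.re - e₁.re) ^ 2 + (e₂.im - e₁.im) ^ 2 := by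
    by_contra! hcon
    have q1 : e₂.re - e₁.re = 0 := by nlinarith [sq_nonneg (e₂.re - e₁.re), sq_nonneg (e₂.im - e₁.im)]
    have q2 : e₂.im - e₁.im = 0 := by nlinarith [sq_nonneg (e₂.re - e₁.re), sq_nonneg (e₂.im - e₁.im)]
    exact hne (Complex.ext (by linarith) (by linarith))
  set m : ℝ := ((x.re - e₁.re) * (e₂.re - e₁.re) + (x.im - e₁.im) * (e₂.im - e₁.im)) /
    ((e₂.re - e₁.re) ^ 2 + (e₂.im - e₁.im) ^ 2) with hm
  have hmm : m * ((e₂.re - e₁.re) ^ 2 + (e₂.im - e₁.im) ^ 2) =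
      (x.re - e₁.re) * (e₂.re - e₁.re) + (x.im - e₁.im) * (e₂.im - e₁.im) :=
    div_mul_cancel₀ _ hd.ne'
  have hxr : x.re = e₁.re + m * (e₂.re - e₁.re) := by
    rw [orient] at hxo
    refine mul_right_cancel₀ hd.ne' ?_
    linear_combination (-(e₂.re - e₁.re)) * hmm - (e₂.im - e₁.im) * hxo
  have hxi : x.im = e₁.im + m * (e₂.im - e₁.im) := by
    rw [orient] at hxo
    refine mul_right_cancel₀ hd.ne' ?_
    linear_combination (-(e₂.im - e₁.im)) * hmm + (e₂.re - e₁.re) * hxo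
  have normsq : ∀ w : ℂ, dist w c ^ 2 = (w.re - c.re) ^ 2 + (w.im - c.im) ^ 2 := by
    intro w
    rw [dist_eq_norm, Complex.sq_norm, Complex.normSq_apply, Complex.sub_re, Complex.sub_im]; ring
  have n1 := normsq e₁
  have n2 := normsq e₂
  have n3 := normsq x
  rw [Metric.mem_sphere.1 he₁] at n1
  rw [Metric.mem_sphere.1 he₂] at n2
  have n4 : dist x c ^ 2 < ρ ^ 2 := pow_lt_pow_left₀ hxball dist_nonneg (by norm_num)
  -- The power of the point `x`: the product of its distances to `e₁` and `e₂` is ρ² - |x - c|² > 0,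
  -- so `x` lies strictly between them.
  have hmpos : 0 < m * (1 - m) := by
    have : m * (1 - m) * ((e₂.re - e₁.re) ^ 2 + (e₂.im - e₁.im) ^ 2) > 0 := by
      have : m * (1 - m) * ((e₂.re - e₁.re) ^ 2 + (e₂.im - e₁.im) ^ 2) =
          ρ ^ 2 - dist x c ^ 2 := by
        rw [n3, hxr, hxi]
        linear_combination (-(1 - m)) * n1 - m * n2
      linarith
    exact (pos_iff_pos_of_mul_pos this).2 hd
  have hm0 : 0 < m := by
    by_contra! h
    nlinarith
  have hm1 : m < 1 := by
    by_contra! h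
    nlinarith
  have k1 : orient f₁ f₂ e₁ = m * (orient e₁ e₂ f₂ - orient e₁ e₂ f₁) := by
    have a1 : x.re = f₁.re + l * (f₂.re - f₁.re) := by simp [hx]
    have a2 : x.im = f₁.im + l * (f₂.im - f₁.im) := by simp [hx]
    simp only [orient]
    linear_combination (f₂.re - f₁.re) * (a2 - hxi) - (f₂.im - f₁.im) * (a1 - hxr)
  have k2 : orient f₁ f₂ e₂ = -(1 - m) * (orient e₁ e₂ f₂ - orient e₁ e₂ f₁) := by
    have : orient f₁ f₂ e₂ = orient f₁ f₂ e₁ - (orient e₁ e₂ f₂ - orient e₁ e₂ f₁) := by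
      simp only [orient]; ring
    rw [this, k1]; ring
  refine ⟨by rw [k1]; positivity, ?_⟩
  rw [k2]
  nlinarith

/-- Disjoint paths in a disc do not have interlaced endpoints on the boundary circle. -/
theorem not_disjoint_of_interlaced_paths {c : ℂ} {ρ : ℝ} {e₁ e₂ f₁ f₂ : ℂ}
    (he₁ : e₁ ∈ Metric.sphere c ρ) (he₂ : e₂ ∈ Metric.sphere c ρ)
    (hf₁ : f₁ ∈ Metric.sphere c ρ) (hf₂ : f₂ ∈ Metric.sphere c ρ)
    (h₁ : orient e₁ e₂ f₁ < 0) (h₂ : 0 < orient e₁ e₂ f₂) {A B : Set ℂ}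
    (hA : A ⊆ Metric.closedBall c ρ) (hB : B ⊆ Metric.closedBall c ρ)
    (hjA : JoinedIn A e₁ e₂) (hjB : JoinedIn B f₁ f₂) : ¬ Disjoint A B := by
  intro hdis
  obtain ⟨g₁, hg₁⟩ := hjA
  obtain ⟨g₂, hg₂⟩ := hjB
  have hA' : ∀ t : ℝ, g₁.extend t ∈ A := fun t => hg₁ _
  have hB' : ∀ t : ℝ, g₂.extend t ∈ B := fun t => hg₂ _
  let g : C(ℝ × ℝ, ℂ) := ⟨fun p => g₁.extend p.1 - g₂.extend p.2, by fun_prop⟩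
  have hg : ∀ p, g p ∈ ({0}ᶜ : Set ℂ) := fun p h =>
    disjoint_left.1 hdis (hA' p.1) (sub_eq_zero.1 h ▸ hB' p.2)
  -- The difference of the two paths never vanishes on the parameter plane, so it has a continuous
  -- logarithm. On each side of the unit square one path rests at a point of the circle, so the
  -- difference stays in an open half-plane and its argument strictly increases. All four increases
  -- around the square are incompatible.
  obtain ⟨k, ⟨-, hk⟩, -⟩ := Complex.isCoveringMapOn_exp.existsUnique_continuousMap_lifts g
    (a₀ := (0, 0)) (e₀ := Complex.log (g (0, 0))) (Complex.exp_log (hg _)) hg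
  have hk' : ∀ s t, Complex.exp (k (s, t)) = g₁.extend s - g₂.extend t := fun s t =>
    congrFun hk (s, t)
  have hAB : ∀ s t, g₁.extend s ≠ g₂.extend t := fun s t h =>
    disjoint_left.1 hdis (hA' s) (h ▸ hB' t)
  obtain ⟨h₃, h₄⟩ := orient_of_interlaced he₁ he₂ hf₁ hf₂ h₁ h₂
  have i1 : (k (0, 0)).im < (k (0, 1)).im := by
    refine im_lt_im_of_half_plane (k := fun t => k (0, t)) (d := e₁ - c) (by fun_prop)
      (fun t _ => ?_) ?_
    · rw [hk', Path.extend_zero]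
      refine inner_pos_of_mem_sphere he₁ (hB (hB' t)) ?_
      have := hAB 0 t
      rw [Path.extend_zero] at this
      exact this.symm
    · simp only [hk', Path.extend_zero, Path.extend_one]
      simp only [orient, Complex.sub_re, Complex.sub_im, Complex.zero_re, Complex.zero_im] at h₃ ⊢
      linarith
  have i2 : (k (0, 1)).im < (k (1, 1)).im := by
    refine im_lt_im_of_half_plane (k := fun t => k (t, 1)) (d := -(f₂ - c)) (by fun_prop)
      (fun t _ => ?_) ?_
    · rw [hk', Path.extend_one, ← neg_sub f₂, inner_neg_neg]
      refine inner_pos_of_mem_sphere hf₂ (hA (hA' t)) ?_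
      have := hAB t 1
      rwa [Path.extend_one] at this
    · simp only [hk', Path.extend_zero, Path.extend_one]
      simp only [orient, Complex.sub_re, Complex.sub_im, Complex.zero_re, Complex.zero_im] at h₂ ⊢
      linarith
  have i3 : (k (1, 1)).im < (k (1, 0)).im := by
    have := im_lt_im_of_half_plane (k := fun t => k (1, 1 - t)) (d := e₂ - c) (by fun_prop)
      (fun t _ => ?_) ?_
    · simpa using this
    · rw [hk', Path.extend_one]
      refine inner_pos_of_mem_sphere he₂ (hB (hB' _)) ?_
      have := hAB 1 (1 - t)
      rw [Path.extend_one] at this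
      exact this.symm
    · simp only [hk', sub_zero, sub_self, Path.extend_zero, Path.extend_one]
      simp only [orient, Complex.sub_re, Complex.sub_im, Complex.zero_re, Complex.zero_im] at h₄ ⊢
      linarith
  have i4 : (k (1, 0)).im < (k (0, 0)).im := by
    have := im_lt_im_of_half_plane (k := fun t => k (1 - t, 0)) (d := -(f₁ - c)) (by fun_prop)
      (fun t _ => ?_) ?_
    · simpa using this
    · rw [hk', Path.extend_zero, ← neg_sub f₁, inner_neg_neg]
      refine inner_pos_of_mem_sphere hf₁ (hA (hA' _)) ?_
      have := hAB (1 - t) 0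
      rwa [Path.extend_zero] at this
    · simp only [hk', sub_zero, sub_self, Path.extend_zero, Path.extend_one]
      simp only [orient, Complex.sub_re, Complex.sub_im, Complex.zero_re, Complex.zero_im] at h₁ ⊢
      linarith
  linarith

/-- Disjoint continua in a disc do not have interlaced points on the boundary circle. -/
theorem not_disjoint_of_interlaced {c : ℂ} {ρ : ℝ} {M N : Set ℂ}
    (hM : IsPreconnected M) (hN : IsPreconnected N) (hMc : IsCompact M) (hNc : IsClosed N)
    (hMD : M ⊆ Metric.closedBall c ρ) (hND : N ⊆ Metric.closedBall c ρ) {e₁ e₂ f₁ f₂ : ℂ}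
    (he₁ : e₁ ∈ M ∩ Metric.sphere c ρ) (he₂ : e₂ ∈ M ∩ Metric.sphere c ρ)
    (hf₁ : f₁ ∈ N ∩ Metric.sphere c ρ) (hf₂ : f₂ ∈ N ∩ Metric.sphere c ρ)
    (h₁ : orient e₁ e₂ f₁ < 0) (h₂ : 0 < orient e₁ e₂ f₂) : ¬ Disjoint M N := by
  intro hdis
  -- Disjoint compact and closed sets have disjoint thickenings, in which the continua may be
  -- replaced by paths.
  obtain ⟨δ, hδ, hthick⟩ := hdis.exists_thickenings hMc hNc
  refine not_disjoint_of_interlaced_paths he₁.2 he₂.2 hf₁.2 hf₂.2 h₁ h₂ inter_subset_left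
    inter_subset_left
    (hM.joinedIn_thickening (convex_closedBall c ρ) hMD hδ he₁.1 he₂.1)
    (hN.joinedIn_thickening (convex_closedBall c ρ) hND hδ hf₁.1 hf₂.1) ?_
  exact hthick.mono inter_subset_right inter_subset_right

/-! ### Convex hulls of traces on the circle -/

theorem orient_rotate (a b c : ℂ) : orient a b c = orient b c a := by
  simp only [orient]; ring

theorem orient_smul_add (p q a b d : ℂ) {α β γ : ℝ} (h : α + β + γ = 1) :
    orient p q (α • a + β • b + γ • d) =
      α * orient p q a + β * orient p q b + γ * orient p q d := by
  simp only [orient, Complex.add_re, Complex.add_im, Complex.smul_re, Complex.smul_im,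
    smul_eq_mul]
  linear_combination (q.re * p.im - p.re * q.im) * h

/-- A line meets a circle in at most two points: for e = p + m (q - p) the circle equations give m
(1 - m) |q - p|² = 0. -/
theorem orient_ne_zero_of_mem_sphere {c : ℂ} {ρ : ℝ} {p q e : ℂ} (hp : p ∈ Metric.sphere c ρ)
    (hq : q ∈ Metric.sphere c ρ) (he : e ∈ Metric.sphere c ρ) (hpq : p ≠ q) (hpe : e ≠ p)
    (hqe : e ≠ q) : orient p q e ≠ 0 := by
  intro ho
  have hd : 0 < (q.re - p.re) ^ 2 + (q.im - p.im) ^ 2 := by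
    by_contra! hcon
    have q1 : q.re - p.re = 0 := by nlinarith [sq_nonneg (q.re - p.re), sq_nonneg (q.im - p.im)]
    have q2 : q.im - p.im = 0 := by nlinarith [sq_nonneg (q.re - p.re), sq_nonneg (q.im - p.im)]
    exact hpq (Complex.ext (by linarith) (by linarith))
  set m : ℝ := ((e.re - p.re) * (q.re - p.re) + (e.im - p.im) * (q.im - p.im)) /
    ((q.re - p.re) ^ 2 + (q.im - p.im) ^ 2) with hm
  have hmm : m * ((q.re - p.re) ^ 2 + (q.im - p.im) ^ 2) =
      (e.re - p.re) * (q.re - p.re) + (e.im - p.im) * (q.im - p.im) :=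
    div_mul_cancel₀ _ hd.ne'
  rw [orient] at ho
  have hxr : e.re = p.re + m * (q.re - p.re) := by
    refine mul_right_cancel₀ hd.ne' ?_
    linear_combination (-(q.re - p.re)) * hmm - (q.im - p.im) * ho
  have hxi : e.im = p.im + m * (q.im - p.im) := by
    refine mul_right_cancel₀ hd.ne' ?_
    linear_combination (-(q.im - p.im)) * hmm + (q.re - p.re) * ho
  have normsq : ∀ w ∈ Metric.sphere c ρ, ρ ^ 2 = (w.re - c.re) ^ 2 + (w.im - c.im) ^ 2 := by
    intro w hw
    rw [← Metric.mem_sphere.1 hw, dist_eq_norm, Complex.sq_norm, Complex.normSq_apply,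
      Complex.sub_re, Complex.sub_im]
    ring
  have n1 := normsq p hp
  have n2 := normsq q hq
  have n3 := normsq e he
  rw [hxr, hxi] at n3
  have h0 : m * (1 - m) * ((q.re - p.re) ^ 2 + (q.im - p.im) ^ 2) = 0 := by
    linear_combination n3 - (1 - m) * n1 - m * n2
  rcases mul_eq_zero.1 ((mul_eq_zero.1 h0).resolve_right hd.ne') with h | h
  · exact hpe (Complex.ext (by rw [hxr, h]; ring) (by rw [hxi, h]; ring))
  · have : m = 1 := by linarith
    exact hqe (Complex.ext (by rw [hxr, this]; ring) (by rw [hxi, this]; ring))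

theorem convex_setOf_orient_pos (p q : ℂ) (σ : ℝ) : Convex ℝ {z | 0 < σ * orient p q z} := by
  intro a ha b hb α β hα hβ h
  have := orient_smul_add p q a b b (α := α) (β := β) (γ := 0) (by linarith)
  simp only [zero_smul, add_zero, zero_mul] at this
  simp only [mem_ofPred_eq] at ha hb ⊢
  rw [this]
  rcases hα.eq_or_lt with rfl | hα
  · have : β = 1 := by linarith
    subst this; simpa using hb
  · nlinarith [mul_pos hα ha, mul_nonneg hβ hb.le]

/-- A positive barycentric combination of three distinct points of a circle is not on it. -/
theorem notMem_sphere_of_pos {c : ℂ} {ρ : ℝ} {p q r : ℂ} (hp : p ∈ Metric.sphere c ρ)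
    (hq : q ∈ Metric.sphere c ρ) (hr : r ∈ Metric.sphere c ρ) (hpq : p ≠ q) {α β γ : ℝ}
    (hα : 0 < α) (hβ : 0 < β) (hγ : 0 < γ) (h : α + β + γ = 1) :
    α • p + β • q + γ • r ∉ Metric.sphere c ρ := by
  intro hs
  have hρ : ρ ≠ 0 := by
    rintro rfl
    simp only [Metric.sphere_zero, mem_singleton_iff] at hp hq
    exact hpq (hp.trans hq.symm)
  have hab : 0 < α + β := by positivity
  have h1 : (α / (α + β)) • p + (β / (α + β)) • q ∈ interior (Metric.closedBall c ρ) :=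
    strictConvex_closedBall ℝ c ρ (Metric.sphere_subset_closedBall hp)
      (Metric.sphere_subset_closedBall hq) hpq (by positivity) (by positivity)
      (by field_simp)
  have h2 := (convex_closedBall c ρ).combo_interior_self_mem_interior h1
    (Metric.sphere_subset_closedBall hr) hab hγ.le h
  rw [smul_add, smul_smul, smul_smul, mul_div_cancel₀ _ hab.ne', mul_div_cancel₀ _ hab.ne',
    interior_closedBall c hρ] at h2
  exact absurd (Metric.mem_sphere.1 hs) (ne_of_lt h2)

/-- The convex hulls of the parts on the boundary circle of two disjoint continua in a disc are
disjoint. -/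
theorem disjoint_convexHull_of_disjoint {c : ℂ} {ρ : ℝ} {M N : Set ℂ}
    (hM : IsPreconnected M) (hN : IsPreconnected N) (hMc : IsCompact M) (hNc : IsClosed N)
    (hMD : M ⊆ Metric.closedBall c ρ) (hND : N ⊆ Metric.closedBall c ρ) (hdis : Disjoint M N)
    {z : ℂ} (hzM : z ∈ convexHull ℝ (M ∩ Metric.sphere c ρ)) (hz : z ∉ M) :
    z ∉ convexHull ℝ (N ∩ Metric.sphere c ρ) := by
  intro hzN
  obtain ⟨e, heN, heS⟩ : (N ∩ Metric.sphere c ρ).Nonempty :=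
    convexHull_nonempty_iff.1 ⟨z, hzN⟩
  -- No chord between points of `M` separates points of `N` on the circle, as these would be
  -- interlaced. So all of them, and hence `z` in their hull, lie strictly on the side of `e`.
  have hside : ∀ p ∈ M ∩ Metric.sphere c ρ, ∀ q ∈ M ∩ Metric.sphere c ρ, p ≠ q →
      0 < orient p q e * orient p q z := by
    intro p hp q hq hpq
    have hne : ∀ f ∈ N ∩ Metric.sphere c ρ, orient p q f ≠ 0 := fun f hf =>
      orient_ne_zero_of_mem_sphere hp.2 hq.2 hf.2 hpq
        (fun h => disjoint_left.1 hdis hp.1 (h ▸ hf.1))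
        (fun h => disjoint_left.1 hdis hq.1 (h ▸ hf.1))
    refine convexHull_min (fun f hf => ?_) (convex_setOf_orient_pos p q (orient p q e)) hzN
    simp only [mem_ofPred_eq]
    rcases lt_or_gt_of_ne (hne e ⟨heN, heS⟩) with h1 | h1 <;>
      rcases lt_or_gt_of_ne (hne f hf) with h2 | h2
    · exact mul_pos_of_neg_of_neg h1 h2
    · exact absurd hdis (not_disjoint_of_interlaced hM hN hMc hNc hMD hND hp hq ⟨heN, heS⟩ hf
        h1 h2)
    · exact absurd hdis (not_disjoint_of_interlaced hM hN hMc hNc hMD hND hp hq hf ⟨heN, heS⟩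
        h2 h1)
    · exact mul_pos h1 h2
  rcases exists_triangle_of_mem_convexHull hzM with h | ⟨p, hp, q, hq, hpq, α, β, hα, hβ, h, rfl⟩ |
      ⟨p, hp, q, hq, r, hr, hpq, hqr, hrp, α, β, γ, hα, hβ, hγ, h, rfl⟩
  · exact hz h.1
  · have h1 := hside p hp q hq hpq
    have h2 : orient p q (α • p + β • q) = 0 := by
      have := orient_smul_add p q p q q (α := α) (β := β) (γ := 0) (by linarith)
      simp only [zero_smul, add_zero] at this
      rw [this]; simp only [orient]; ring
    rw [h2] at h1
    simp at h1
  · have self₁ : ∀ a b : ℂ, orient a b a = 0 := fun a b => by simp [orient]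
    have self₂ : ∀ a b : ℂ, orient a b b = 0 := fun a b => by simp only [orient]; ring
    have h1 := hside p hp q hq hpq
    have h2 := hside q hq r hr hqr
    have h3 := hside r hr p hp hrp
    rw [orient_smul_add _ _ _ _ _ h] at h1 h2 h3
    simp only [self₁, self₂, mul_zero, zero_add, add_zero] at h1 h2 h3
    rw [← orient_rotate p q r] at h2
    rw [orient_rotate r p q] at h3
    set o := orient p q r with ho
    have ho0 : o ≠ 0 := by rintro h0; simp [h0] at h1
    -- Barycentric coordinates with respect to p, q, r are quotients of orientations by `o`. Since
    -- `e` is on the same side of each edge as `z`, whose coordinates are positive, those of `e` are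
    -- positive too, which would place `e` strictly inside the circle.
    have key : ∀ {x y : ℝ}, 0 < y → 0 < x * (y * o) → 0 < x / o := by
      intro x y hy hxy
      have : 0 < x * o := by
        have : 0 < y * (x * o) := by linarith
        exact (pos_iff_pos_of_mul_pos this).1 hy
      have h5 : x / o = x * o / o ^ 2 := by field_simp
      rw [h5]; positivity
    have hsum : orient q r e / o + orient r p e / o + orient p q e / o = 1 := by
      rw [← add_div, ← add_div, div_eq_one_iff_eq ho0, ho]
      simp only [orient]; ring
    refine notMem_sphere_of_pos hp.2 hq.2 hr.2 hpq (key hα h2) (key hβ h3) (key hγ h1) hsum ?_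
    convert heS using 1
    apply Complex.ext
    · simp only [Complex.add_re, Complex.smul_re, smul_eq_mul]
      field_simp
      rw [ho]; simp only [orient]; ring
    · simp only [Complex.add_im, Complex.smul_im, smul_eq_mul]
      field_simp
      rw [ho]; simp only [orient]; ring

/-! ### Convexity of level set components in a disc -/

section
variable {Ω : Set ℂ} {u : ℂ → ℝ} {c : ℂ} {ρ : ℝ}

theorem ContinuousOn.isCompact_sep_closedBall (hu : ContinuousOn u Ω)
    (hD : Metric.closedBall c ρ ⊆ Ω) {s : Set ℝ} (hs : IsClosed s) :
    IsCompact ({z ∈ Ω | u z ∈ s} ∩ Metric.closedBall c ρ) := by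
  have h1 : {z ∈ Ω | u z ∈ s} ∩ Metric.closedBall c ρ = Metric.closedBall c ρ ∩ u ⁻¹' s := by
    ext z
    exact ⟨fun h => ⟨h.2, h.1.2⟩, fun h => ⟨⟨hD h.1, h.2⟩, h.1⟩⟩
  rw [h1]
  exact (isCompact_closedBall c ρ).of_isClosed_subset
    ((hu.mono hD).preimage_isClosed_of_isClosed Metric.isClosed_closedBall hs) inter_subset_left

theorem isCompact_connectedComponentIn {Y : Set ℂ} (hY : IsCompact Y) (z : ℂ) :
    IsCompact (connectedComponentIn Y z) := by
  by_cases hz : z ∈ Y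
  · have : CompactSpace Y := isCompact_iff_compactSpace.1 hY
    rw [connectedComponentIn_eq_image hz]
    exact isClosed_connectedComponent.isCompact.image continuous_subtype_val
  · rw [connectedComponentIn_eq_empty hz]
    exact isCompact_empty

theorem subset_convexHull_of_untouchable {X : Set ℂ} (hX : Untouchable X)
    (hc : IsCompact (X ∩ Metric.closedBall c ρ)) (z : ℂ) :
    connectedComponentIn (X ∩ Metric.closedBall c ρ) z ⊆
      convexHull ℝ (connectedComponentIn (X ∩ Metric.closedBall c ρ) z ∩ Metric.sphere c ρ) := by
  intro w hw
  have := hX.mem_convexHull hc (connectedComponentIn_subset _ _ hw)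
  rwa [← connectedComponentIn_eq hw] at this

/-- At a point w of the hull with u w ≠ a, the component through w of {u ≤ u w} or {u ≥ u w},
whichever excludes the value a, is disjoint from the component of the level set, while w lies in
both boundary hulls. So the hull lies in the level set and, being connected, in the component. -/
theorem LocalMedianValueProperty.convexHull_inter_sphere_subset
    (hmed : LocalMedianValueProperty Ω u) (hΩ : IsOpen Ω) (hu : ContinuousOn u Ω)
    (hD : Metric.closedBall c ρ ⊆ Ω) (a : ℝ) (z : ℂ) :
    convexHull ℝ (connectedComponentIn ({z ∈ Ω | u z = a} ∩ Metric.closedBall c ρ) z ∩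
      Metric.sphere c ρ) ⊆ connectedComponentIn ({z ∈ Ω | u z = a} ∩ Metric.closedBall c ρ) z := by
  set M := connectedComponentIn ({z ∈ Ω | u z = a} ∩ Metric.closedBall c ρ) z with hM
  have hcomp := hu.isCompact_sep_closedBall hD (isClosed_singleton (x := a))
  have hMsub : M ⊆ {z ∈ Ω | u z = a} ∩ Metric.closedBall c ρ := connectedComponentIn_subset _ _
  have hMc : IsCompact M := isCompact_connectedComponentIn hcomp z
  have hHD : convexHull ℝ (M ∩ Metric.sphere c ρ) ⊆ Metric.closedBall c ρ :=
    convexHull_min (inter_subset_right.trans Metric.sphere_subset_closedBall)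
      (convex_closedBall c ρ)
  have aux : ∀ w ∈ convexHull ℝ (M ∩ Metric.sphere c ρ), ∀ s : Set ℝ, IsClosed s →
      Untouchable {z ∈ Ω | u z ∈ s} → u w ∈ s → a ∉ s → False := by
    intro w hw s hs hX hws ha
    have hwD := hHD hw
    have hwX : w ∈ {z ∈ Ω | u z ∈ s} ∩ Metric.closedBall c ρ := ⟨⟨hD hwD, hws⟩, hwD⟩
    have hc := hu.isCompact_sep_closedBall hD hs
    have hN := isCompact_connectedComponentIn hc w
    have hNsub := connectedComponentIn_subset ({z ∈ Ω | u z ∈ s} ∩ Metric.closedBall c ρ) w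
    refine disjoint_convexHull_of_disjoint isPreconnected_connectedComponentIn
      isPreconnected_connectedComponentIn hMc hN.isClosed (fun x hx => (hMsub hx).2)
      (fun x hx => (hNsub hx).2) ?_ hw ?_ (hX.mem_convexHull hc hwX)
    · exact disjoint_left.2 fun x hx hx' => ha ((hMsub hx).1.2 ▸ (hNsub hx').1.2)
    · exact fun h => ha ((hMsub h).1.2 ▸ hws)
  have hL : convexHull ℝ (M ∩ Metric.sphere c ρ) ⊆
      {z ∈ Ω | u z = a} ∩ Metric.closedBall c ρ := by
    refine fun w hw => ⟨⟨hD (hHD hw), ?_⟩, hHD hw⟩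
    by_contra hne
    rcases lt_or_gt_of_ne hne with h | h
    · exact aux w hw (Iic (u w)) isClosed_Iic (hmed.untouchable_le hΩ hu _) self_mem_Iic
        (not_le.2 h)
    · exact aux w hw (Ici (u w)) isClosed_Ici (hmed.untouchable_ge hΩ hu _) self_mem_Ici
        (not_le.2 h)
  rcases (M ∩ Metric.sphere c ρ).eq_empty_or_nonempty with h0 | ⟨q, hq⟩
  · rw [h0, convexHull_empty]
    exact empty_subset _
  · have hMq : M = connectedComponentIn ({z ∈ Ω | u z = a} ∩ Metric.closedBall c ρ) q :=
      connectedComponentIn_eq hq.1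
    refine Subset.trans ?_ hMq.symm.subset
    exact (convex_convexHull ℝ _).isPreconnected.subset_connectedComponentIn
      (subset_convexHull ℝ (M ∩ Metric.sphere c ρ) hq) hL

theorem LocalMedianValueProperty.connectedComponentIn_eq_convexHull
    (hmed : LocalMedianValueProperty Ω u) (hΩ : IsOpen Ω) (hu : ContinuousOn u Ω)
    (hD : Metric.closedBall c ρ ⊆ Ω) (a : ℝ) (z : ℂ) :
    connectedComponentIn ({z ∈ Ω | u z = a} ∩ Metric.closedBall c ρ) z =
      convexHull ℝ (connectedComponentIn ({z ∈ Ω | u z = a} ∩ Metric.closedBall c ρ) z ∩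
        Metric.sphere c ρ) :=
  (subset_convexHull_of_untouchable (hmed.untouchable_eq hΩ hu a)
    (hu.isCompact_sep_closedBall hD (isClosed_singleton (x := a))) z).antisymm
    (hmed.convexHull_inter_sphere_subset hΩ hu hD a z)

/-- The components of a level set in a disc are convex. -/
theorem LocalMedianValueProperty.convex_connectedComponentIn
    (hmed : LocalMedianValueProperty Ω u) (hΩ : IsOpen Ω) (hu : ContinuousOn u Ω)
    (hD : Metric.closedBall c ρ ⊆ Ω) (a : ℝ) (z : ℂ) :
    Convex ℝ (connectedComponentIn ({z ∈ Ω | u z = a} ∩ Metric.closedBall c ρ) z) := by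
  rw [hmed.connectedComponentIn_eq_convexHull hΩ hu hD a z]
  exact convex_convexHull ℝ _

end

/-! ### Chords in the frontier of a path component -/

/-- If the maximum of a linear functional over the convex hull of a set is attained at a point,
then this point is in the convex hull of the points of the set where the maximum is attained. -/
theorem mem_convexHull_face {Q : Set ℂ} {n z : ℂ} (hQ : ∀ w ∈ Q, inner ℝ n (w - z) ≤ 0)
    (hz : z ∈ convexHull ℝ Q) : z ∈ convexHull ℝ {w ∈ Q | inner ℝ n (w - z) = 0} := by
  set H := convexHull ℝ {w ∈ Q | inner ℝ n (w - z) = 0} with hH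
  have hHc : Convex ℝ H := convex_convexHull ℝ _
  have hcomb : ∀ x y : ℂ, ∀ α β : ℝ, α + β = 1 → inner ℝ n (α • x + β • y - z) =
      α * inner ℝ n (x - z) + β * inner ℝ n (y - z) := by
    intro x y α β h
    rw [← real_inner_smul_right, ← real_inner_smul_right, ← inner_add_right]
    congr 1
    have : α • x + β • y - z = α • x + β • y - (α + β) • z := by rw [h, one_smul]
    rw [this, add_smul, smul_sub, smul_sub]; abel
  -- As `H` lies in the closed half-plane, positive weights and one point in the open half-plane
  -- give a point of the open half-plane. The union is thus convex and contains `Q`, while `z` is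
  -- not in the open half-plane.
  have hconv : Convex ℝ ({w | inner ℝ n (w - z) < 0} ∪ H) := by
    have hle : ∀ w ∈ {w | inner ℝ n (w - z) < 0} ∪ H, inner ℝ n (w - z) ≤ 0 := by
      have hHle : H ⊆ {w | inner ℝ n (w - z) ≤ 0} := by
        refine convexHull_min (fun w hw => hw.2.le) fun x hx y hy α β hα hβ h => ?_
        simp only [mem_ofPred_eq] at hx hy ⊢
        rw [hcomb x y α β h]
        nlinarith
      rintro w (hw | hw)
      · exact le_of_lt hw
      · exact hHle hw
    intro x hx y hy α β hα hβ h
    rcases hα.eq_or_lt with rfl | hα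
    · have : β = 1 := by linarith
      subst this; simpa using hy
    rcases hβ.eq_or_lt with rfl | hβ
    · have : α = 1 := by linarith
      subst this; simpa using hx
    have h1 := hle x hx
    have h2 := hle y hy
    rcases hx with hx | hx
    · left
      simp only [mem_ofPred_eq] at hx ⊢
      rw [hcomb x y α β h]
      nlinarith [mul_neg_of_pos_of_neg hα hx]
    rcases hy with hy | hy
    · left
      simp only [mem_ofPred_eq] at hy ⊢
      rw [hcomb x y α β h]
      nlinarith [mul_neg_of_pos_of_neg hβ hy]
    · exact Or.inr (hHc hx hy hα.le hβ.le h)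
  have hsub : Q ⊆ {w | inner ℝ n (w - z) < 0} ∪ H := by
    intro w hw
    rcases (hQ w hw).lt_or_eq with h | h
    · exact Or.inl h
    · exact Or.inr (subset_convexHull ℝ _ ⟨hw, h⟩)
  rcases convexHull_min hsub hconv hz with h | h
  · simp at h
  · exact h

theorem Convex.preimage_line {M : Set ℂ} (hM : Convex ℝ M) (z v : ℂ) :
    OrdConnected {t : ℝ | z + t • v ∈ M} := by
  refine Convex.ordConnected fun s hs t ht α β hα hβ h => ?_
  have := hM hs ht hα hβ h
  simp only [mem_ofPred_eq]
  convert this using 1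
  have e : z = (α + β) • z := by rw [h, one_smul]
  conv_lhs => rw [e]
  simp only [smul_add, add_smul, smul_smul, smul_eq_mul]
  abel

/-- A half-line from an interior point of a disc that contains a point of the boundary circle
contains the whole part of it in the disc before this point. -/
theorem lt_of_add_smul_mem_ball {c z v : ℂ} {ρ s t : ℝ} (hz : z ∈ Metric.ball c ρ)
    (hs : z + s • v ∈ Metric.sphere c ρ) (hs0 : 0 < s) (ht : z + t • v ∈ Metric.ball c ρ) :
    t < s := by
  by_contra! hst
  have h0 : z + (0 : ℝ) • v ∈ Metric.ball c ρ := by simpa using hz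
  exact absurd (Metric.mem_sphere.1 hs)
    (ne_of_lt (((convex_ball c ρ).preimage_line z v).out h0 ht ⟨hs0.le, hst⟩))

theorem inner_I_mul_self (n : ℂ) : inner ℝ n (Complex.I * n) = 0 := by
  simp [Complex.inner]; ring

/-- Coordinates with respect to an orthogonal basis of the plane. -/
theorem eq_smul_of_inner_eq_zero {n w : ℂ} (hn : n ≠ 0) (h : inner ℝ n w = 0) :
    w = (inner ℝ (Complex.I * n) w / ‖n‖ ^ 2) • (Complex.I * n) := by
  have hn2 : ‖n‖ ^ 2 = n.re ^ 2 + n.im ^ 2 := by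
    rw [Complex.sq_norm, Complex.normSq_apply]; ring
  have hpos : n.re ^ 2 + n.im ^ 2 ≠ 0 := by
    rw [← hn2]; exact pow_ne_zero 2 (norm_ne_zero_iff.2 hn)
  rw [hn2]
  set t : ℝ := inner ℝ (Complex.I * n) w / (n.re ^ 2 + n.im ^ 2) with ht
  have htm : t * (n.re ^ 2 + n.im ^ 2) = inner ℝ (Complex.I * n) w := div_mul_cancel₀ _ hpos
  simp only [Complex.inner, Complex.mul_re, Complex.mul_im, Complex.conj_re, Complex.conj_im,
    Complex.I_re, Complex.I_im] at h htm
  apply Complex.ext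
  · simp only [Complex.smul_re, Complex.mul_re, Complex.I_re, Complex.I_im, smul_eq_mul]
    refine mul_right_cancel₀ hpos ?_
    linear_combination n.re * h + n.im * htm
  · simp only [Complex.smul_im, Complex.mul_im, Complex.I_re, Complex.I_im, smul_eq_mul]
    refine mul_right_cancel₀ hpos ?_
    linear_combination n.im * h - n.re * htm

section
variable {Ω : Set ℂ} {u : ℂ → ℝ} {c : ℂ} {ρ : ℝ}

theorem Convex.subset_pathComponentIn {T L : Set ℂ} (hT : Convex ℝ T) (hTL : T ⊆ L) {x k : ℂ}
    (hk : k ∈ T) (hkK : k ∈ pathComponentIn L x) : T ⊆ pathComponentIn L x := fun y hy =>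
  JoinedIn.trans hkK (((hT.isPathConnected ⟨k, hk⟩).joinedIn k hk y hy).mono hTL)

/-- If z is in the closure of the path component, the component meets the interior of T and
therefore absorbs all of T. -/
theorem Convex.notMem_frontier_pathComponentIn {T L : Set ℂ} (hT : Convex ℝ T) (hTL : T ⊆ L)
    {x z : ℂ} (hz : z ∈ interior T) : z ∉ frontier (pathComponentIn L x) := by
  intro hf
  obtain ⟨k, hk, hkK⟩ := mem_closure_iff.1 hf.1 _ isOpen_interior hz
  exact hf.2 (interior_mono (hT.subset_pathComponentIn hTL (interior_subset hk) hkK) hz)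

/-- The level set is relatively closed in Ω by continuity. -/
theorem frontier_pathComponentIn_inter_subset (hΩ : IsOpen Ω) (hu : ContinuousOn u Ω) (a : ℝ)
    (x : ℂ) : frontier (pathComponentIn {z ∈ Ω | u z = a} x) ∩ Ω ⊆ {z ∈ Ω | u z = a} := by
  rintro z ⟨hz, hzΩ⟩
  refine ⟨hzΩ, ?_⟩
  by_contra hne
  have hopen : IsOpen (Ω ∩ u ⁻¹' {a}ᶜ) := hu.isOpen_inter_preimage hΩ isOpen_compl_singleton
  obtain ⟨k, hk, hkK⟩ := mem_closure_iff.1 hz.1 _ hopen ⟨hzΩ, hne⟩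
  exact hk.2 (pathComponentIn_subset hkK).2

/-- Close to a point of a path component `K` of a level set and a point not in `K`, there is a
chord of any given disc contained in `∂K`. -/
theorem LocalMedianValueProperty.exists_chord_near (hmed : LocalMedianValueProperty Ω u)
    (hΩ : IsOpen Ω) (hu : ContinuousOn u Ω) (hD : Metric.closedBall c ρ ⊆ Ω) {a : ℝ} {x k y : ℂ}
    (hk : k ∈ pathComponentIn {z ∈ Ω | u z = a} x)
    (hy : y ∉ pathComponentIn {z ∈ Ω | u z = a} x)
    (hball : Metric.closedBall y (dist k y) ⊆ Metric.ball c ρ) :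
    ∃ z v : ℂ, dist z y ≤ dist k y ∧ ‖v‖ = 1 ∧ ∀ t : ℝ, z + t • v ∈ Metric.ball c ρ →
      z + t • v ∈ frontier (pathComponentIn {z ∈ Ω | u z = a} x) := by
  set L := {z ∈ Ω | u z = a} with hL
  set K := pathComponentIn L x with hK
  have hKL : K ⊆ L := pathComponentIn_subset
  set M := connectedComponentIn (L ∩ Metric.closedBall c ρ) k with hM
  have hcomp : IsCompact (L ∩ Metric.closedBall c ρ) :=
    hu.isCompact_sep_closedBall hD (isClosed_singleton (x := a))
  have hMc : IsCompact M := isCompact_connectedComponentIn hcomp k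
  have hMconv : Convex ℝ M := hmed.convex_connectedComponentIn hΩ hu hD a k
  have hMhull : M = convexHull ℝ (M ∩ Metric.sphere c ρ) :=
    hmed.connectedComponentIn_eq_convexHull hΩ hu hD a k
  have hMsub : M ⊆ L ∩ Metric.closedBall c ρ := connectedComponentIn_subset _ _
  have hkM : k ∈ M := mem_connectedComponentIn ⟨hKL hk,
    Metric.ball_subset_closedBall (hball (Metric.mem_closedBall.2 le_rfl))⟩
  have hMK : M ⊆ K := hMconv.subset_pathComponentIn (fun w hw => (hMsub hw).1) hkM hk
  -- The point of `M` nearest to `y`. The line through it orthogonal to y - z supports `M` and will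
  -- carry the chord.
  obtain ⟨z, hzM, hzmin⟩ := exists_norm_eq_iInf_of_complete_convex ⟨k, hkM⟩ hMc.isComplete
    hMconv y
  have hsupp := (norm_eq_iInf_iff_real_inner_le_zero hMconv hzM).1 hzmin
  have hzk : dist z y ≤ dist k y := by
    rw [dist_comm z, dist_comm k, dist_eq_norm, dist_eq_norm, hzmin]
    exact ciInf_le (f := fun w : M => ‖y - w‖)
      ⟨0, by rintro _ ⟨w, rfl⟩; exact norm_nonneg _⟩ ⟨k, hkM⟩
  have hzb : z ∈ Metric.ball c ρ := hball hzk
  set n := y - z with hn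
  have hn0 : n ≠ 0 := sub_ne_zero.2 fun h => hy (h ▸ hMK hzM)
  have hn1 : 0 < ‖n‖ := norm_pos_iff.2 hn0
  set w₀ := Complex.I * n with hw₀
  -- As `z` is in the hull of `M ∩ Metric.sphere c ρ`, it is in the hull of the points of this trace
  -- on the supporting line. These differ from `z`, which lies in the open disc, so there are some
  -- on both sides of it.
  have hface := mem_convexHull_face (fun w hw => hsupp w hw.1) (hMhull ▸ hzM)
  have hline : ∀ w ∈ {w ∈ M ∩ Metric.sphere c ρ | inner ℝ n (w - z) = 0},
      ∃ t : ℝ, t ≠ 0 ∧ w = z + t • w₀ ∧ inner ℝ w₀ (w - z) = t * ‖n‖ ^ 2 := by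
    rintro w ⟨hw, hw0⟩
    have h1 := eq_smul_of_inner_eq_zero hn0 hw0
    refine ⟨inner ℝ w₀ (w - z) / ‖n‖ ^ 2, fun h0 => ?_, ?_, by field_simp⟩
    · rw [← hw₀, h0, zero_smul, sub_eq_zero] at h1
      rw [h1] at hw
      exact absurd (Metric.mem_sphere.1 hw.2) (ne_of_lt hzb)
    · rw [← hw₀] at h1
      rw [← h1]; ring
  have hend : ∀ σ : ℝ, σ ≠ 0 → ∃ t : ℝ, 0 < σ * t ∧ z + t • w₀ ∈ M ∩ Metric.sphere c ρ := by
    intro σ hσ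
    by_contra! hcon
    have hsub : {w ∈ M ∩ Metric.sphere c ρ | inner ℝ n (w - z) = 0} ⊆
        {w | inner ℝ (σ • w₀) w < inner ℝ (σ • w₀) z} := by
      intro w hw
      obtain ⟨t, ht0, hwt, hin⟩ := hline w hw
      have h1 : σ * t < 0 := by
        refine lt_of_le_of_ne (not_lt.1 fun h => hcon t h (hwt ▸ hw.1)) (mul_ne_zero hσ ht0)
      simp only [mem_ofPred_eq]
      rw [← sub_neg, ← inner_sub_right, real_inner_smul_left, hin, ← mul_assoc]
      exact mul_neg_of_neg_of_pos h1 (by positivity)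
    have hhalf : Convex ℝ {w | inner ℝ (σ • w₀) w < inner ℝ (σ • w₀) z} :=
      convex_halfSpace_lt (innerₗ ℂ (σ • w₀)).isLinear _
    exact lt_irrefl _ (mem_ofPred.1 (convexHull_min hsub hhalf hface))
  obtain ⟨t₁, ht₁, hq₁⟩ := hend 1 one_ne_zero
  obtain ⟨t₂, ht₂, hq₂⟩ := hend (-1) (by norm_num)
  have hchord : ∀ t : ℝ, z + t • w₀ ∈ Metric.ball c ρ → z + t • w₀ ∈ M := by
    intro t ht
    refine (hMconv.preimage_line z w₀).out hq₂.1 hq₁.1 ⟨?_, ?_⟩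
    · have := lt_of_add_smul_mem_ball (v := -w₀) (s := -t₂) (t := -t) hzb
        (by simpa using hq₂.2) (by linarith) (by simpa using ht)
      linarith
    · exact (lt_of_add_smul_mem_ball hzb hq₁.2 (by linarith) ht).le
  refine ⟨z, (‖n‖⁻¹ : ℝ) • w₀, hzk, ?_, fun t ht => ?_⟩
  · rw [norm_smul, hw₀, norm_mul, Complex.norm_I, one_mul, norm_inv, norm_norm,
      inv_mul_cancel₀ hn1.ne']
  · rw [smul_smul] at ht ⊢
    set s := t * ‖n‖⁻¹
    have hwM := hchord s ht
    refine ⟨subset_closure (hMK hwM), fun hint => ?_⟩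
    -- A ball in `K` and in the disc around a point of `M` would lie in the component `M`, and hence
    -- would contain points of `M` beyond the supporting line, in direction `n`.
    obtain ⟨ε, hε, hεb⟩ := Metric.isOpen_iff.1 (isOpen_interior.inter Metric.isOpen_ball) _
      (⟨hint, ht⟩ : z + s • w₀ ∈ interior K ∩ Metric.ball c ρ)
    have hMs : M = connectedComponentIn (L ∩ Metric.closedBall c ρ) (z + s • w₀) :=
      connectedComponentIn_eq hwM
    have hbM : Metric.ball (z + s • w₀) ε ⊆ M := by
      rw [hMs]
      refine (convex_ball _ ε).isPreconnected.subset_connectedComponentIn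
        (Metric.mem_ball_self hε) fun w hw => ?_
      exact ⟨hKL (interior_subset (hεb hw).1), Metric.ball_subset_closedBall (hεb hw).2⟩
    have hmem : z + s • w₀ + (ε / 2 * ‖n‖⁻¹) • n ∈ M := by
      refine hbM ?_
      rw [Metric.mem_ball, dist_eq_norm, add_sub_cancel_left, norm_smul, norm_mul, norm_inv,
        norm_norm, mul_assoc, inv_mul_cancel₀ hn1.ne', mul_one, Real.norm_of_nonneg (by positivity)]
      linarith
    have h1 := hsupp _ hmem
    have h2 : z + s • w₀ + (ε / 2 * ‖n‖⁻¹) • n - z = s • w₀ + (ε / 2 * ‖n‖⁻¹) • n := by ring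
    rw [h2, inner_add_right, real_inner_smul_right, hw₀, inner_I_mul_self, mul_zero, zero_add,
      real_inner_smul_right, real_inner_self_eq_norm_sq] at h1
    have : 0 < ε / 2 * ‖n‖⁻¹ * ‖n‖ ^ 2 := by positivity
    linarith

/-- Through each point of `∂K` in an open disc there is a line whose part in the disc is
contained in `∂K`. -/
theorem LocalMedianValueProperty.exists_chord (hmed : LocalMedianValueProperty Ω u)
    (hΩ : IsOpen Ω) (hu : ContinuousOn u Ω) (hD : Metric.closedBall c ρ ⊆ Ω) {a : ℝ} {x z : ℂ}
    (hz : z ∈ frontier (pathComponentIn {z ∈ Ω | u z = a} x)) (hzb : z ∈ Metric.ball c ρ) :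
    ∃ v : ℂ, ‖v‖ = 1 ∧ ∀ t : ℝ, z + t • v ∈ Metric.ball c ρ →
      z + t • v ∈ frontier (pathComponentIn {z ∈ Ω | u z = a} x) := by
  set K := pathComponentIn {z ∈ Ω | u z = a} x with hK
  obtain ⟨ε, hε, hεb⟩ := Metric.isOpen_iff.1 Metric.isOpen_ball z hzb
  have hstep : ∀ m : ℕ, ∃ z' v : ℂ, dist z' z < 3 * (ε / 4 / (m + 1)) ∧ ‖v‖ = 1 ∧
      ∀ t : ℝ, z' + t • v ∈ Metric.ball c ρ → z' + t • v ∈ frontier K := by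
    intro m
    -- With `k` and `y` within δ of `z`, the closed ball around `y` through `k` stays within 3δ < ε
    -- of `z`, hence in the disc.
    set δ : ℝ := ε / 4 / (m + 1) with hδ
    have hδ0 : 0 < δ := by positivity
    have hδε : δ ≤ ε / 4 := div_le_self (by positivity) (by linarith [m.cast_nonneg (α := ℝ)])
    rw [frontier_eq_closure_inter_closure] at hz
    obtain ⟨k, hk, hkz⟩ := Metric.mem_closure_iff.1 hz.1 δ hδ0
    obtain ⟨y, hy, hyz⟩ := Metric.mem_closure_iff.1 hz.2 δ hδ0
    rw [dist_comm] at hkz hyz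
    have hky : dist k y < 2 * δ := by linarith [dist_triangle_right k y z]
    obtain ⟨z', v, h1, h2, h3⟩ := hmed.exists_chord_near hΩ hu hD hk hy (fun w hw => hεb (by
      rw [Metric.mem_ball]
      linarith [dist_triangle w y z, Metric.mem_closedBall.1 hw]))
    exact ⟨z', v, by linarith [dist_triangle z' y z], h2, h3⟩
  choose z' v hz' hv hfr using hstep
  -- The unit directions subconverge, and the limit chord remains in the closed set `frontier K`.
  obtain ⟨w, hw, φ, hφ, hlim⟩ := (isCompact_sphere (0 : ℂ) 1).tendsto_subseq
    (x := v) (fun m => by simpa using hv m)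
  refine ⟨w, by simpa using hw, fun t ht => ?_⟩
  have hz'lim : Filter.Tendsto z' Filter.atTop (nhds z) := by
    rw [tendsto_iff_dist_tendsto_zero]
    refine squeeze_zero (fun _ => dist_nonneg) (fun m => (hz' m).le) ?_
    have := (tendsto_one_div_add_atTop_nhds_zero_nat (𝕜 := ℝ)).const_mul (3 * (ε / 4))
    rw [mul_zero] at this
    refine this.congr fun m => ?_
    ring
  have hlim2 : Filter.Tendsto (fun m => z' (φ m) + t • v (φ m)) Filter.atTop
      (nhds (z + t • w)) :=
    (hz'lim.comp hφ.tendsto_atTop).add (hlim.const_smul t)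
  refine isClosed_frontier.mem_of_tendsto hlim2 ?_
  filter_upwards [hlim2.eventually (Metric.isOpen_ball.mem_nhds ht)] with m hm using
    hfr _ t hm

/-- Two segments through a point of `∂K` contained in the level set are parallel. -/
theorem LocalMedianValueProperty.orient_eq_zero (hmed : LocalMedianValueProperty Ω u)
    (hΩ : IsOpen Ω) (hu : ContinuousOn u Ω) {a : ℝ} {x z v w : ℂ} {ε : ℝ} (hε : 0 < ε)
    (hz : z ∈ frontier (pathComponentIn {z ∈ Ω | u z = a} x)) (hzΩ : z ∈ Ω) (hv : ‖v‖ = 1)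
    (hw : ‖w‖ = 1) (hvL : ∀ t : ℝ, |t| < ε → z + t • v ∈ {z ∈ Ω | u z = a})
    (hwL : ∀ t : ℝ, |t| < ε → z + t • w ∈ {z ∈ Ω | u z = a}) : orient 0 v w = 0 := by
  by_contra ho
  obtain ⟨δ, hδ, hball⟩ := Metric.isOpen_iff.1 hΩ z hzΩ
  set r := min (ε / 2) (δ / 2) with hr
  have hr0 : 0 < r := by positivity
  have hD : Metric.closedBall z r ⊆ Ω := fun y hy => hball (by
    rw [Metric.mem_ball]
    linarith [min_le_right (ε / 2) (δ / 2), Metric.mem_closedBall.1 hy])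
  set M := connectedComponentIn ({z ∈ Ω | u z = a} ∩ Metric.closedBall z r) z with hM
  have hMconv : Convex ℝ M := hmed.convex_connectedComponentIn hΩ hu hD a z
  have hdiam : ∀ b : ℂ, ‖b‖ = 1 → (∀ t : ℝ, |t| < ε → z + t • b ∈ {z ∈ Ω | u z = a}) →
      ∀ t : ℝ, |t| ≤ r → z + t • b ∈ M := by
    intro b hb hbL t ht
    have hpre : IsPreconnected ((fun t : ℝ => z + t • b) '' Icc (-r) r) :=
      isPreconnected_Icc.image _ (by fun_prop)
    refine hpre.subset_connectedComponentIn ⟨0, ⟨by linarith, hr0.le⟩, by simp⟩ ?_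
      ⟨t, abs_le.1 ht, rfl⟩
    rintro _ ⟨s, hs, rfl⟩
    have hs' : |s| ≤ r := abs_le.2 hs
    refine ⟨hbL s ?_, ?_⟩
    · linarith [min_le_left (ε / 2) (δ / 2)]
    · simpa [Metric.mem_closedBall, dist_eq_norm, norm_smul, hb] using hs'
  -- An open parallelogram around `z`, in coordinates α, β along `v` and `w`. Each of its points is
  -- the midpoint of z + 2αv and z + 2βw, both in the convex set `M`, so `z` is interior to `M`.
  have hU : IsOpen ({y | |orient 0 (y - z) w / orient 0 v w| < r / 2} ∩
      {y | |orient 0 v (y - z) / orient 0 v w| < r / 2}) := by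
    refine (isOpen_lt ?_ continuous_const).inter (isOpen_lt ?_ continuous_const) <;>
    · unfold orient
      fun_prop
  refine hMconv.notMem_frontier_pathComponentIn
    ((connectedComponentIn_subset _ _).trans inter_subset_left) (x := x) (z := z) ?_ hz
  refine mem_interior.2 ⟨_, ?_, hU, ?_⟩
  · rintro y ⟨h1, h2⟩
    set α := orient 0 (y - z) w / orient 0 v w with hα
    set β := orient 0 v (y - z) / orient 0 v w with hβ
    have m1 := hdiam v hv hvL (2 * α) (by rw [abs_mul, abs_two]; linarith [mem_ofPred.1 h1])
    have m2 := hdiam w hw hwL (2 * β) (by rw [abs_mul, abs_two]; linarith [mem_ofPred.1 h2])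
    have m3 := hMconv m1 m2 (a := 1 / 2) (b := 1 / 2) (by norm_num) (by norm_num) (by norm_num)
    have hα' : α * orient 0 v w = orient 0 (y - z) w := div_mul_cancel₀ _ ho
    have hβ' : β * orient 0 v w = orient 0 v (y - z) := div_mul_cancel₀ _ ho
    convert m3 using 1
    simp only [orient, Complex.zero_re, Complex.zero_im, sub_zero, Complex.sub_re,
      Complex.sub_im] at ho hα' hβ'
    apply Complex.ext
    · simp only [Complex.add_re, Complex.smul_re, smul_eq_mul]
      refine mul_right_cancel₀ ho ?_
      linear_combination (-v.re) * hα' - w.re * hβ'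
    · simp only [Complex.add_im, Complex.smul_im, smul_eq_mul]
      refine mul_right_cancel₀ ho ?_
      linear_combination (-v.im) * hα' - w.im * hβ'
  · simp [orient, hr0]

end

/-! ### From chords to segments across the domain -/

theorem eq_smul_of_orient_eq_zero {v w : ℂ} (hv : ‖v‖ = 1) (hw : ‖w‖ = 1)
    (h : orient 0 v w = 0) : ∃ s : ℝ, s ≠ 0 ∧ v = s • w := by
  have hw2 : w.re ^ 2 + w.im ^ 2 = 1 := by
    have := Complex.sq_norm w
    rw [hw, Complex.normSq_apply] at this
    linarith
  simp only [orient, Complex.zero_re, Complex.zero_im, sub_zero] at h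
  have hvw : v = (v.re * w.re + v.im * w.im) • w := by
    apply Complex.ext
    · rw [Complex.smul_re, smul_eq_mul]
      linear_combination (-v.re) * hw2 + w.im * h
    · rw [Complex.smul_im, smul_eq_mul]
      linear_combination (-v.im) * hw2 - w.re * h
  refine ⟨_, fun h0 => ?_, hvw⟩
  rw [h0, zero_smul] at hvw
  simp [hvw] at hv

/-- Open intervals are the only nonempty open connected sets of real numbers. -/
theorem IsPreconnected.eq_interval_of_isOpen {J : Set ℝ} (hJ : IsPreconnected J) (hJo : IsOpen J)
    (hne : J.Nonempty) : (∃ α β, α < β ∧ α ∉ J ∧ β ∉ J ∧ J = Ioo α β) ∨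
      (∃ α, α ∉ J ∧ J = Ioi α) ∨ (∃ β, β ∉ J ∧ J = Iio β) ∨ J = univ := by
  have hsup : BddAbove J → ∀ t ∈ J, t < sSup J := fun hb t ht => by
    obtain ⟨ε, hε, hball⟩ := Metric.isOpen_iff.1 hJo t ht
    have : t + ε / 2 ∈ J := hball (by
      rw [Metric.mem_ball, Real.dist_eq, add_sub_cancel_left, abs_of_pos (by positivity)]
      linarith)
    linarith [le_csSup hb this]
  have hinf : BddBelow J → ∀ t ∈ J, sInf J < t := fun hb t ht => by
    obtain ⟨ε, hε, hball⟩ := Metric.isOpen_iff.1 hJo t ht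
    have : t - ε / 2 ∈ J := hball (by
      rw [Metric.mem_ball, Real.dist_eq, sub_sub_cancel_left, abs_neg, abs_of_pos (by positivity)]
      linarith)
    linarith [csInf_le hb this]
  obtain ⟨t, ht⟩ := hne
  by_cases ha : BddAbove J <;> by_cases hb : BddBelow J
  · exact Or.inl ⟨sInf J, sSup J, (hinf hb t ht).trans (hsup ha t ht),
      fun h => lt_irrefl _ (hinf hb _ h), fun h => lt_irrefl _ (hsup ha _ h),
      Subset.antisymm (fun s hs => ⟨hinf hb s hs, hsup ha s hs⟩) (IsConnected.Ioo_csInf_csSup_subset ⟨⟨t, ht⟩, hJ⟩ hb ha)⟩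
  · exact Or.inr (Or.inr (Or.inl ⟨sSup J, fun h => lt_irrefl _ (hsup ha _ h),
      Subset.antisymm (fun s hs => hsup ha s hs) (hJ.Iio_csSup_subset hb ha)⟩))
  · exact Or.inr (Or.inl ⟨sInf J, fun h => lt_irrefl _ (hinf hb _ h),
      Subset.antisymm (fun s hs => hinf hb s hs) (hJ.Ioi_csInf_subset hb ha)⟩)
  · exact Or.inr (Or.inr (Or.inr (hJ.eq_univ_of_unbounded hb ha)))

/-- Adding a limit point keeps a connected set connected. On a line, this puts the missing endpoints
of a component of the part in Ω on ∂Ω. -/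
theorem closure_connectedComponentIn_inter_subset {X : Type*} [TopologicalSpace X] (Z : Set X)
    (x : X) : closure (connectedComponentIn Z x) ∩ Z ⊆ connectedComponentIn Z x := by
  rintro y ⟨hy, hyZ⟩
  by_cases hx : x ∈ Z
  · have hpre : IsPreconnected (insert y (connectedComponentIn Z x)) :=
      isPreconnected_connectedComponentIn.subset_closure (subset_insert _ _)
        (insert_subset hy subset_closure)
    exact hpre.subset_connectedComponentIn (mem_insert_of_mem _ (mem_connectedComponentIn hx))
      (insert_subset hyZ (connectedComponentIn_subset _ _)) (mem_insert _ _)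
  · rw [connectedComponentIn_eq_empty hx, closure_empty] at hy
    exact hy.elim

/-- The closure of the component containing `z` of the part in `Ω` of a line through `z`. -/
theorem exists_isSegmentAcross {Ω : Set ℂ} (hΩ : IsOpen Ω) {z v : ℂ} (hz : z ∈ Ω) (hv : v ≠ 0)
    {F : Set ℂ} (hF : ∀ t ∈ connectedComponentIn {t : ℝ | z + t • v ∈ Ω} 0, z + t • v ∈ F) :
    ∃ C, IsSegmentAcross Ω C ∧ z ∈ C ∧ C ∩ Ω ⊆ F := by
  set Z := {t : ℝ | z + t • v ∈ Ω} with hZ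
  set J := connectedComponentIn Z 0 with hJ
  have hcont : Continuous fun t : ℝ => z + t • v := by fun_prop
  have hZo : IsOpen Z := hΩ.preimage hcont
  have h0 : (0 : ℝ) ∈ J := mem_connectedComponentIn (by simpa [hZ] using hz)
  have hJZ : J ⊆ Z := connectedComponentIn_subset _ _
  have hend : ∀ t ∈ closure J, t ∉ J → z + t • v ∈ frontier Ω := by
    intro t ht htJ
    rw [hΩ.frontier_eq]
    refine ⟨?_, fun h => htJ (closure_connectedComponentIn_inter_subset Z 0 ⟨ht, h⟩)⟩
    exact closure_mono (image_subset_iff.2 hJZ)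
      (image_closure_subset_closure_image hcont (mem_image_of_mem _ ht))
  have hnot : ∀ {p}, p ∈ frontier Ω → p ∉ Ω := fun {p} hp => by
    rw [hΩ.frontier_eq] at hp
    exact hp.2
  rcases isPreconnected_connectedComponentIn.eq_interval_of_isOpen hZo.connectedComponentIn
    ⟨0, h0⟩ with ⟨α, β, hαβ, hα, hβ, hJe⟩ | ⟨α, hα, hJe⟩ | ⟨β, hβ, hJe⟩ | hJe
  · rw [← hJ] at hα hβ hJe
    have hcl : closure J = Icc α β := by rw [hJe, closure_Ioo hαβ.ne]
    have hp := hend α (by rw [hcl]; exact left_mem_Icc.2 hαβ.le) hα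
    have hq := hend β (by rw [hcl]; exact right_mem_Icc.2 hαβ.le) hβ
    have hpq : z + α • v ≠ z + β • v := fun h =>
      hαβ.ne (smul_left_injective ℝ hv (add_left_cancel h))
    have himg : (fun t : ℝ => z + t • v) '' Ioo α β = openSegment ℝ (z + α • v) (z + β • v) := by
      have e1 : Ioo α β = openSegment ℝ α β := (openSegment_eq_Ioo hαβ).symm
      have e2 : (fun t : ℝ => z + t • v) = AffineMap.lineMap z (z + v) := by
        ext1 t
        simp [AffineMap.lineMap_apply, add_comm]
      rw [e1, e2, image_openSegment]
      simp [AffineMap.lineMap_apply, add_comm]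
    have hsub : openSegment ℝ (z + α • v) (z + β • v) ⊆ Ω ∩ F := by
      rw [← himg, ← hJe]
      rintro _ ⟨t, ht, rfl⟩
      exact ⟨hJZ ht, hF t ht⟩
    refine ⟨_, Or.inl ⟨_, _, hpq, hp, hq, hsub.trans inter_subset_left, rfl⟩, ?_, ?_⟩
    · refine openSegment_subset_segment ℝ _ _ ?_
      rw [← himg, ← hJe]
      exact ⟨0, h0, by simp⟩
    · rintro w ⟨hw, hwΩ⟩
      rw [← insert_endpoints_openSegment] at hw
      rcases hw with rfl | rfl | hw
      · exact absurd hwΩ (hnot hp)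
      · exact absurd hwΩ (hnot hq)
      · exact (hsub hw).2
  · rw [← hJ] at hα hJe
    have hp := hend α (by rw [hJe, closure_Ioi]; exact self_mem_Ici) hα
    have hshift : ∀ t : ℝ, z + α • v + t • v = z + (α + t) • v := fun t => by
      rw [add_smul, add_assoc]
    have hin : ∀ t : ℝ, 0 < t → α + t ∈ J := fun t ht => by
      rw [hJe]; exact lt_add_of_pos_right α ht
    refine ⟨_, Or.inr (Or.inl ⟨z + α • v, v, hv, hp, fun t ht => ?_, rfl⟩), ?_, ?_⟩
    · rw [hshift]; exact hJZ (hin t ht)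
    · refine ⟨-α, ?_, by rw [hshift]; simp⟩
      rw [hJe] at h0
      exact (neg_pos.2 h0).le
    · rintro w ⟨⟨t, ht, rfl⟩, hwΩ⟩
      rcases ht.eq_or_lt with rfl | ht
      · rw [zero_smul, add_zero] at hwΩ
        exact absurd hwΩ (hnot hp)
      · rw [hshift]; exact hF _ (hin t ht)
  · rw [← hJ] at hβ hJe
    have hp := hend β (by rw [hJe, closure_Iio]; exact self_mem_Iic) hβ
    -- Reversing the direction turns the interval unbounded below into a half-line starting on ∂Ω.
    have hshift : ∀ t : ℝ, z + β • v + t • -v = z + (β - t) • v := fun t => by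
      rw [sub_smul, smul_neg, add_assoc, sub_eq_add_neg]
    have hin : ∀ t : ℝ, 0 < t → β - t ∈ J := fun t ht => by
      rw [hJe]; exact sub_lt_self β ht
    refine ⟨_, Or.inr (Or.inl ⟨z + β • v, -v, neg_ne_zero.2 hv, hp, fun t ht => ?_, rfl⟩), ?_, ?_⟩
    · rw [hshift]; exact hJZ (hin t ht)
    · refine ⟨β, ?_, by rw [hshift]; simp⟩
      rw [hJe] at h0
      exact (le_of_lt h0)
    · rintro w ⟨⟨t, ht, rfl⟩, hwΩ⟩
      rcases ht.eq_or_lt with rfl | ht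
      · rw [zero_smul, add_zero] at hwΩ
        exact absurd hwΩ (hnot hp)
      · rw [hshift]; exact hF _ (hin t ht)
  · rw [← hJ] at hJe
    have hall : ∀ t : ℝ, t ∈ J := fun t => hJe ▸ mem_univ t
    refine ⟨_, Or.inr (Or.inr ⟨z, v, hv, fun t => hJZ (hall t), rfl⟩), ⟨0, by simp⟩, ?_⟩
    rintro w ⟨⟨t, rfl⟩, -⟩
    exact hF t (hall t)

theorem IsSegmentAcross.subset_closure_inter {Ω C : Set ℂ} (h : IsSegmentAcross Ω C) :
    C ⊆ closure (C ∩ Ω) := by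
  rcases h with ⟨p, q, -, -, -, hΩ, rfl⟩ | ⟨p, v, -, -, hΩ, rfl⟩ | ⟨p, v, -, hΩ, rfl⟩
  · exact segment_subset_closure_openSegment.trans
      (closure_mono (subset_inter (openSegment_subset_segment ℝ p q) hΩ))
  · rintro _ ⟨t, ht, rfl⟩
    have h1 : t ∈ closure (Ioi (0 : ℝ)) := by rw [closure_Ioi]; exact ht
    refine closure_mono ?_ (image_closure_subset_closure_image
      (f := fun t : ℝ => p + t • v) (by fun_prop) (mem_image_of_mem _ h1))
    rintro _ ⟨s, hs, rfl⟩
    exact ⟨⟨s, le_of_lt hs, rfl⟩, hΩ s hs⟩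
  · rintro _ ⟨t, rfl⟩
    exact subset_closure ⟨⟨t, rfl⟩, hΩ t⟩

/-- Through each point of `∂K` in `Ω` there is a line whose part in `Ω` around this point is
contained in `∂K`. -/
theorem LocalMedianValueProperty.exists_line {Ω : Set ℂ} {u : ℂ → ℝ}
    (hmed : LocalMedianValueProperty Ω u) (hΩ : IsOpen Ω) (hu : ContinuousOn u Ω) {a : ℝ}
    {x z : ℂ} (hz : z ∈ frontier (pathComponentIn {z ∈ Ω | u z = a} x)) (hzΩ : z ∈ Ω) :
    ∃ v : ℂ, v ≠ 0 ∧ ∀ t ∈ connectedComponentIn {t : ℝ | z + t • v ∈ Ω} 0,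
      z + t • v ∈ frontier (pathComponentIn {z ∈ Ω | u z = a} x) := by
  set L := {z ∈ Ω | u z = a} with hL
  set F := frontier (pathComponentIn L x) with hF
  have hFL : F ∩ Ω ⊆ L := frontier_pathComponentIn_inter_subset hΩ hu a x
  have hdisc : ∀ p ∈ Ω, ∃ ρ > 0, Metric.closedBall p ρ ⊆ Ω := fun p hp =>
    Metric.nhds_basis_closedBall.mem_iff.1 (hΩ.mem_nhds hp)
  obtain ⟨ρ, hρ, hD⟩ := hdisc z hzΩ
  obtain ⟨v, hv, hvF⟩ := hmed.exists_chord hΩ hu hD hz (Metric.mem_ball_self hρ)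
  have hdist : ∀ s t : ℝ, dist (z + s • v) (z + t • v) = |s - t| := fun s t => by
    rw [dist_add_left, dist_eq_norm, ← sub_smul, norm_smul, hv, mul_one, Real.norm_eq_abs]
  refine ⟨v, by rintro rfl; simp at hv, fun t ht => ?_⟩
  set G := interior {t : ℝ | z + t • v ∈ F} with hG
  have hGF : ∀ s ∈ G, z + s • v ∈ F := fun s hs =>
    (interior_subset hs : s ∈ {t : ℝ | z + t • v ∈ F})
  suffices h : connectedComponentIn {t : ℝ | z + t • v ∈ Ω} 0 ⊆ G from hGF t (h ht)
  have hmemG : ∀ {s r : ℝ}, 0 < r → (∀ y : ℝ, |y - s| < r → z + y • v ∈ F) → s ∈ G :=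
    fun {s r} hr h => mem_interior.2 ⟨Metric.ball s r, fun y hy => h y hy, Metric.isOpen_ball,
      Metric.mem_ball_self hr⟩
  have h0 : (0 : ℝ) ∈ G := by
    refine hmemG hρ fun y hy => hvF y ?_
    have := hdist y 0
    rw [zero_smul, add_zero] at this
    rwa [Metric.mem_ball, this]
  -- The open set `G` is also relatively closed in the component. Near a limit parameter `s` choose
  -- `s'` in `G`. The chord through z + s' v of a disc around z + s v must be parallel to `v`, so it
  -- lies on the same line and covers z + s v.
  refine isPreconnected_connectedComponentIn.subset_of_closure_inter_subset isOpen_interior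
    ⟨0, mem_connectedComponentIn (by simpa using hzΩ), h0⟩ ?_
  rintro s ⟨hsG, hsJ⟩
  have hsΩ : z + s • v ∈ Ω :=
    (connectedComponentIn_subset _ _ hsJ : s ∈ {t : ℝ | z + t • v ∈ Ω})
  obtain ⟨r, hr, hDs⟩ := hdisc _ hsΩ
  obtain ⟨s', hs'G, hs's⟩ := Metric.mem_closure_iff.1 hsG r hr
  rw [dist_comm, Real.dist_eq] at hs's
  have hs'F : z + s' • v ∈ F := hGF s' hs'G
  have hs'b : z + s' • v ∈ Metric.ball (z + s • v) r := by rwa [Metric.mem_ball, hdist]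
  obtain ⟨w, hw, hwF⟩ := hmed.exists_chord hΩ hu hDs hs'F hs'b
  have hbΩ := Metric.ball_subset_closedBall.trans hDs
  obtain ⟨ε₁, hε₁, hb₁⟩ := Metric.isOpen_iff.1 Metric.isOpen_ball _ hs'b
  obtain ⟨ε₂, hε₂, hb₂⟩ := Metric.isOpen_iff.1 isOpen_interior _ hs'G
  have hpar := hmed.orient_eq_zero hΩ hu (lt_min hε₁ hε₂) hs'F (hbΩ hs'b) hv hw
    (fun t ht => by
      have e : z + s' • v + t • v = z + (s' + t) • v := by rw [add_smul, add_assoc]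
      refine hFL ⟨?_, hbΩ (hb₁ ?_)⟩
      · rw [e]
        refine hGF _ (hb₂ ?_)
        rw [Metric.mem_ball, Real.dist_eq, add_sub_cancel_left]
        exact ht.trans_le (min_le_right _ _)
      · rw [Metric.mem_ball, dist_eq_norm, add_sub_cancel_left, norm_smul, hv, mul_one]
        exact ht.trans_le (min_le_left _ _))
    (fun t ht => by
      have hin : z + s' • v + t • w ∈ Metric.ball (z + s • v) r := hb₁ (by
        rw [Metric.mem_ball, dist_eq_norm, add_sub_cancel_left, norm_smul, hw, mul_one]
        exact ht.trans_le (min_le_left _ _))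
      exact hFL ⟨hwF t hin, hbΩ hin⟩)
  obtain ⟨k, -, hvw⟩ := eq_smul_of_orient_eq_zero hv hw hpar
  refine hmemG hr fun y hy => ?_
  have e : z + y • v = z + s' • v + ((y - s') * k) • w := by
    rw [mul_smul, ← hvw, sub_smul]; abel
  rw [e]
  refine hwF _ ?_
  rwa [← e, Metric.mem_ball, hdist]

/-! ### Nonemptiness of the frontier and conclusion -/

/-- A connected set that meets a set and its complement meets the frontier. -/
theorem IsPreconnected.nonempty_inter_frontier {X : Type*} [TopologicalSpace X] {s t : Set X}
    (ht : IsPreconnected t) (h₁ : (t ∩ s).Nonempty) (h₂ : (t ∩ sᶜ).Nonempty) :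
    (t ∩ frontier s).Nonempty := by
  by_contra hcon
  have hmem : ∀ x ∈ t, x ∉ frontier s := fun x hx h => hcon ⟨x, hx, h⟩
  have hin : ∀ x ∈ t, x ∈ s → x ∈ interior s := fun x hx hs => by
    by_contra h
    exact hmem x hx ⟨subset_closure hs, h⟩
  have hout : ∀ x ∈ t, x ∈ sᶜ → x ∈ interior sᶜ := fun x hx hs => by
    by_contra h
    exact hmem x hx (frontier_compl s ▸ ⟨subset_closure hs, h⟩)
  obtain ⟨x, hx, hxs⟩ := h₁
  obtain ⟨y, hy, hys⟩ := h₂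
  obtain ⟨w, -, hw, hw'⟩ := ht _ _ isOpen_interior isOpen_interior
    (fun w hw => (em (w ∈ s)).imp (hin w hw) (hout w hw)) ⟨x, hx, hin x hx hxs⟩
    ⟨y, hy, hout y hy hys⟩
  exact interior_subset hw' (interior_subset hw)

theorem theorem1 (Ω : Set ℂ) (hΩ : IsOpen Ω) (hconn : IsConnected Ω)
    (u : ℂ → ℝ) (hu : ContinuousOn u Ω) (hnonconst : ∃ x ∈ Ω, ∃ y ∈ Ω, u x ≠ u y)
    (hmed : LocalMedianValueProperty Ω u)
    (a : ℝ) (K : Set ℂ)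
    (hK : ∃ x ∈ {z ∈ Ω | u z = a}, K = pathComponentIn {z ∈ Ω | u z = a} x) :
    ∃ S : Set (Set ℂ), S.Nonempty ∧ (∀ C ∈ S, IsSegmentAcross Ω C) ∧
      frontier K ∩ Ω = (⋃ C ∈ S, C) ∩ Ω ∧
      closure (frontier K ∩ Ω) =
        (⋃ C ∈ S, C) ∪ (closure (⋃ C ∈ S, C) ∩ frontier Ω) := by
  obtain ⟨x, hx, rfl⟩ := hK
  set K := pathComponentIn {z ∈ Ω | u z = a} x with hK
  have hthrough : ∀ z ∈ frontier K ∩ Ω, ∃ C, IsSegmentAcross Ω C ∧ z ∈ C ∧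
      C ∩ Ω ⊆ frontier K := by
    rintro z ⟨hz, hzΩ⟩
    obtain ⟨v, hv, hF⟩ := hmed.exists_line hΩ hu hz hzΩ
    exact exists_isSegmentAcross hΩ hzΩ hv hF
  have hne : (Ω ∩ frontier K).Nonempty := by
    refine hconn.isPreconnected.nonempty_inter_frontier ⟨x, hx.1, mem_pathComponentIn_self hx⟩ ?_
    obtain ⟨y₁, hy₁, y₂, hy₂, hy⟩ := hnonconst
    by_cases h : u y₁ = a
    · exact ⟨y₂, hy₂, fun h' => hy (h.trans (pathComponentIn_subset h').2.symm)⟩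
    · exact ⟨y₁, hy₁, fun h' => h (pathComponentIn_subset h').2⟩
  -- The largest admissible family, so the union formula in Ω needs only one segment through each
  -- frontier point.
  set S : Set (Set ℂ) := {C | IsSegmentAcross Ω C ∧ C ∩ Ω ⊆ frontier K} with hS
  have hunion : frontier K ∩ Ω = (⋃ C ∈ S, C) ∩ Ω := by
    ext z
    constructor
    · intro hz
      obtain ⟨C, hC, hzC, hCF⟩ := hthrough z hz
      exact ⟨mem_iUnion₂.2 ⟨C, ⟨hC, hCF⟩, hzC⟩, hz.2⟩
    · rintro ⟨hz, hzΩ⟩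
      obtain ⟨C, hC, hzC⟩ := mem_iUnion₂.1 hz
      exact ⟨hC.2 ⟨hzC, hzΩ⟩, hzΩ⟩
  have hcl : (⋃ C ∈ S, C) ⊆ closure (frontier K ∩ Ω) := by
    refine iUnion₂_subset fun C hC => hC.1.subset_closure_inter.trans (closure_mono ?_)
    exact fun w hw => ⟨hC.2 hw, hw.2⟩
  refine ⟨S, ?_, fun C hC => hC.1, hunion, Subset.antisymm (fun w hw => ?_) (union_subset hcl ?_)⟩
  · obtain ⟨z, hzΩ, hz⟩ := hne
    obtain ⟨C, hC, -, hCF⟩ := hthrough z ⟨hz, hzΩ⟩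
    exact ⟨C, hC, hCF⟩
  -- A limit point in Ω is itself a frontier point because `frontier K` is closed; any other one
  -- lies on ∂Ω.
  · by_cases hwΩ : w ∈ Ω
    · left
      have hwF : w ∈ frontier K := isClosed_frontier.closure_subset_iff.2 inter_subset_left hw
      have : w ∈ (⋃ C ∈ S, C) ∩ Ω := hunion ▸ ⟨hwF, hwΩ⟩
      exact this.1
    · right
      refine ⟨closure_mono ?_ hw, ?_⟩
      · rw [hunion]; exact inter_subset_left
      · rw [hΩ.frontier_eq]
        exact ⟨closure_mono inter_subset_right hw, hwΩ⟩
  · exact inter_subset_left.trans (closure_minimal hcl isClosed_closure)
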